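/- Let $K,n,T\ge 1$ be integers, let $\mathcal X$ be a measurable space and $\mathcal Z=\mathcal X\times\mathbb R$. Let $\ell:\mathbb R\times\mathbb R\to[0,1]$ be a measurable loss function that is $1$-Lipschitz in its first argument for every value of the second. Let $\mathcal F$ be a class of functions $f:\mathbb R^K\to\mathbb R$ with Lipschitz constant at most $L$ (for the Euclidean norm), $L>0$, and let $\mathcal H$ be a class of measurable functions $h:\mathcal X\to\mathbb R^K$ which is pointwise separable: there is a countable $\mathcal H_0\subseteq\mathcal H$ such that every $h\in\mathcal H$ is the pointwise limit of a sequence in $\mathcal H_0$. For $h\in\mathcal H$ and a sample $\mathbf z=((x_1,y_1),\dots,(x_n,y_n))\in\mathcal Z^n$ let $$m(h)_{\mathbf z}=\min_{f\in\mathcal F}\frac1n\sum_{i=1}^n\ell(f(h(x_i)),y_i),$$ assume that the minimum is attained, let $\hat f_{h,\mathbf z}\in\mathcal F$ be a minimizer, chosen so that $\mathbf z\mapsto\hat f_{h,\mathbf z}(v)$ is measurable for every $v\in\mathbb R^K$, and put $a(h)_{\mathbf z}=\hat f_{h,\mathbf z}\circ h$. Let the environment $\eta$ be a probability measure on the set of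 probability measures on $\mathcal Z$. Define the measures $\mu_\eta(S)=\mathbb E_{\mu\sim\eta}[\mu(S)]$ on $\mathcal Z$ and $\rho_\eta(S)=\mathbb E_{\mu\sim\eta}[\mu^n(S)]$ on $\mathcal Z^n$, and the environment risk $$\mathcal E_\eta(h)=\mathbb E_{\mu\sim\eta}\,\mathbb E_{\mathbf Z\sim\mu^n}\,\mathbb E_{(X,Y)\sim\mu}\big[\ell(a(h)_{\mathbf Z}(X),Y)\big].$$ Let $\bar{\mathbf Z}=(\mathbf Z_1,\dots,\mathbf Z_T)\sim\rho_\eta^T$, where $\mathbf Z_t=((X_{t1},Y_{t1}),\dots,(X_{tn},Y_{tn}))$, $\mathbf X_t=(X_{t1},\dots,X_{tn})$ and $\bar{\mathbf X}=(\mathbf X_1,\dots,\mathbf X_T)$. With independent standard normal variables $\gamma_{kti}$, $\gamma_i$, independent of the data, let $$G(\mathcal H(\bar{\mathbf X}))=\mathbb E\Big[\sup_{h\in\mathcal H}\sum_{k=1}^K\sum_{t=1}^T\sum_{i=1}^n\gamma_{kti}h_k(X_{ti})\,\Big|\,\bar{\mathbf X}\Big],\qquad Q'=\sup_{y\in\mathbb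 R^{Kn}\setminus\{0\}}\frac1{\|y\|}\,\mathbb E\sup_{f\in\mathcal F}\sum_{i=1}^n\gamma_if(y_i),$$ where $y=(y_1,\dots,y_n)$ with $y_i\in\mathbb R^K$, and let $\|h(\mathbf X_t)\|=\big(\sum_{i=1}^n\|h(X_{ti})\|^2\big)^{1/2}$. Assume $Q'<\infty$ (this holds, for example, if $f(0)=0$ for all $f\in\mathcal F$). The other suprema and expectations on the right-hand sides below may be infinite, with $0\cdot\infty=0$. Let $\delta\in(0,1)$. (i) With probability at least $1-\delta$ in $\bar{\mathbf Z}\sim\rho_\eta^T$ it holds for every $h\in\mathcal H$ that $$\mathcal E_\eta(h)-\frac1T\sum_{t=1}^Tm(h)_{\mathbf Z_t}\le\frac{\sqrt{2\pi}\,L\,G(\mathcal H(\bar{\mathbf X}))}{T\sqrt n}+\sqrt{2\pi}\,Q'\sup_{h\in\mathcal H}\sqrt{\frac{\mathbb E_{(X,Y)\sim\mu_\eta}\big[\|h(X)\|^2\big]}{n}}+\sqrt{\frac{9\ln(2/\delta)}{2T}}.$$ (ii) With probability at least $1-\delta$ in $\bar{\mathbf Z}\sim\rho_\eta^T$ it holds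 for every $h\in\mathcal H$ that $$\mathcal E_\eta(h)-\frac1T\sum_{t=1}^Tm(h)_{\mathbf Z_t}\le\frac{\sqrt{2\pi}\,L\,G(\mathcal H(\bar{\mathbf X}))}{T\sqrt n}+\frac{\sqrt{2\pi}\,Q'\sum_{t=1}^T\sup_{h\in\mathcal H}\|h(\mathbf X_t)\|}{nT}+\sqrt{\frac{16\ln(4/\delta)}{T}}.$$ In both parts the set of exceptional multisamples has outer measure at most $\delta$. -/

import Mathlib

open MeasureTheory ProbabilityTheory Filter Topology
open scoped ENNReal NNReal

noncomputable section

namespace MTRL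

/-- Observations: pairs of an input and a real label. -/
abbrev Obs (X : Type*) : Type _ := X × ℝ

/-- The representation space `ℝ^K` with its Euclidean norm. -/
abbrev Rep (K : ℕ) : Type := EuclideanSpace ℝ (Fin K)

/-- The expectation, in `[-∞, ∞]`, of an extended real random variable: the expectation of its
positive part minus the expectation of its negative part. -/
def eexpect {Ω : Type*} [MeasurableSpace Ω] (P : Measure Ω) (g : Ω → EReal) : EReal :=
  ((∫⁻ ω, (g ω).toENNReal ∂P : ℝ≥0∞) : EReal) - ((∫⁻ ω, (-g ω).toENNReal ∂P : ℝ≥0∞) : EReal)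

/-- The law of a family of independent standard normal variables indexed by `ι`. -/
def stdNormal (ι : Type*) [Fintype ι] : Measure (ι → ℝ) :=
  Measure.pi fun _ => gaussianReal 0 1

/-- The Gaussian average `G(Y) = 𝔼 sup_{y ∈ Y} ∑ i, γ i * y i` of a set `Y ⊆ ℝ^ι`
(it is `∞` exactly when the nonempty set `Y` is unbounded). -/
def gaussAvg {ι : Type*} [Fintype ι] (Y : Set (ι → ℝ)) : EReal :=
  eexpect (stdNormal ι) fun γ => ⨆ y ∈ Y, ((∑ i, γ i * y i : ℝ) : EReal)

/-- The Euclidean norm of `y = (y_1, …, y_n)` in `(ℝ^K)^n = ℝ^{Kn}`. -/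
def blockNorm {n K : ℕ} (y : Fin n → Rep K) : ℝ :=
  √(∑ i, ‖y i‖ ^ 2)

/-- The set `𝓗(X̄) = {(h_k(x_{ti}))_{kti} : h ∈ 𝓗}`. -/
def repImage {X : Type*} {T n K : ℕ} (H : Set (X → Rep K)) (x : Fin T → Fin n → X) :
    Set (Fin K × Fin T × Fin n → ℝ) :=
  {v | ∃ h ∈ H, v = fun p => h (x p.2.1 p.2.2) p.1}

/-- `Q'(𝓕) = sup_{y ∈ ℝ^{Kn} ∖ {0}} ‖y‖⁻¹ 𝔼 sup_{f ∈ 𝓕} ∑ i, γ i * f (y i)`, in `[0, ∞]`. -/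
def QPrime {K : ℕ} (n : ℕ) (F : Set (Rep K → ℝ)) : EReal :=
  ⨆ (y : Fin n → Rep K) (_ : y ≠ 0),
    (((blockNorm y)⁻¹ : ℝ) : EReal) * gaussAvg {v : Fin n → ℝ | ∃ f ∈ F, v = fun i => f (y i)}

/-- The empirical risk of `f ∘ h` on the sample `z`. -/
def empRisk {X : Type*} {n K : ℕ} (ℓ : ℝ → ℝ → ℝ) (f : Rep K → ℝ) (h : X → Rep K)
    (z : Fin n → Obs X) : ℝ :=
  (1 / (n : ℝ)) * ∑ i, ℓ (f (h (z i).1)) (z i).2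

/-- The minimal empirical risk `m(h)_z` over `f ∈ 𝓕`. -/
def minEmpRisk {X : Type*} {n K : ℕ} (ℓ : ℝ → ℝ → ℝ) (F : Set (Rep K → ℝ)) (h : X → Rep K)
    (z : Fin n → Obs X) : ℝ :=
  ⨅ f : F, empRisk ℓ f.1 h z

/-- `A h z` is a minimizer over `f ∈ 𝓕` of the empirical risk of `f ∘ h` on the sample `z`, for
every representation `h ∈ 𝓗`, and it depends measurably on the sample. -/
structure IsERM {X : Type*} [MeasurableSpace X] {n K : ℕ} (ℓ : ℝ → ℝ → ℝ) (H : Set (X → Rep K))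
    (F : Set (Rep K → ℝ)) (A : (X → Rep K) → (Fin n → Obs X) → (Rep K → ℝ)) : Prop where
  mem : ∀ h ∈ H, ∀ z, A h z ∈ F
  le : ∀ h ∈ H, ∀ z, ∀ f ∈ F, empRisk ℓ (A h z) h z ≤ empRisk ℓ f h z
  measurable : ∀ h ∈ H, ∀ v : Rep K, Measurable fun z => A h z v

/-- The mixture `μ_η(S) = 𝔼_{μ ∼ η} μ(S)` on observations. -/
def mixture {X : Type*} [MeasurableSpace X] (η : Measure (ProbabilityMeasure (Obs X))) :
    Measure (Obs X) :=
  η.bind fun μ => (μ : Measure (Obs X))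

/-- The law `ρ_η(S) = 𝔼_{μ ∼ η} μ^n(S)` of an `n`-sample from a random task. -/
def sampleLaw {X : Type*} [MeasurableSpace X] (η : Measure (ProbabilityMeasure (Obs X)))
    (n : ℕ) : Measure (Fin n → Obs X) :=
  η.bind fun μ => Measure.pi fun _ : Fin n => (μ : Measure (Obs X))

/-- The environment risk `𝓔_η(h) = 𝔼_{μ ∼ η} 𝔼_{Z ∼ μ^n} 𝔼_{(X, Y) ∼ μ} ℓ(a(h)_Z(X), Y)` of the
algorithm `a(h)_Z = (A h Z) ∘ h`. -/
def envRisk {X : Type*} [MeasurableSpace X] {n K : ℕ} (ℓ : ℝ → ℝ → ℝ)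
    (η : Measure (ProbabilityMeasure (Obs X)))
    (A : (X → Rep K) → (Fin n → Obs X) → (Rep K → ℝ)) (h : X → Rep K) : ℝ :=
  ∫ μ : ProbabilityMeasure (Obs X), ∫ z : Fin n → Obs X, ∫ p : Obs X,
    ℓ (A h z (h p.1)) p.2 ∂(μ : Measure (Obs X))
      ∂(Measure.pi fun _ : Fin n => (μ : Measure (Obs X))) ∂η

/-- Pointwise separability: a countable subclass is sequentially dense for pointwise
convergence. -/
def PointwiseSeparable {X : Type*} {K : ℕ} (H : Set (X → Rep K)) : Prop :=
  ∃ H₀ ⊆ H, H₀.Countable ∧ ∀ h ∈ H, ∃ u : ℕ → X → Rep K,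
    (∀ k, u k ∈ H₀) ∧ ∀ x, Tendsto (fun k => u k x) atTop (𝓝 (h x))

end MTRL

end

/-!
The excess of a representation `h` splits as
`(𝓔_η(h) - 𝔼 m(h)_Z) + (1 / T) ∑ t, (𝔼 m(h)_Z - m(h)_{Z_t})`.

The second term is, uniformly in `h`, a supremum with bounded differences. By McDiarmid's
inequality and symmetrization it is controlled by the Rademacher average of the vectors
`(m(h)_{Z_t})_t`, itself a functional with bounded differences. A minimum of empirical risks is
`L / √n`-Lipschitz in the representation of the sample, so comparing each sign with a Gaussian
linear form, whose mean absolute value is `√(2 / π)` times the Euclidean norm, replaces this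
Rademacher average by `G(𝓗(X̄))`.

In the first term, `𝓔_η(h) - 𝔼 m(h)_Z` is an overfitting gap within one task. Symmetrization
over the predictors and the same comparison bound it by `√(2π) (Q' / n) 𝔼 ‖h(X)‖`. Part (i)
follows from Jensen's inequality. For part (ii) the supremum over `h` of the Rademacher averages
is included, as a function of the sample, in the functional to which McDiarmid's inequality is
applied, so that its expectation is replaced by its observed mean.

Measurability of the suprema comes from countable pointwise skeletons: that of `𝓗` is assumed,
and that of `𝓕` exists because the continuous functions on `ℝ^K` form a second countable space.
-/

open scoped BigOperators

noncomputable section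

namespace MTRL

section Suprema

variable {ι : Type*} [Nonempty ι]

lemma abs_ciSup_le {f : ι → ℝ} {C : ℝ} (h : ∀ i, |f i| ≤ C) : |⨆ i, f i| ≤ C := by
  have i : ι := Classical.arbitrary ι
  have hbdd : BddAbove (Set.range f) := ⟨C, Set.forall_mem_range.2 fun i => (abs_le.1 (h i)).2⟩
  exact abs_le.2 ⟨(abs_le.1 (h i)).1.trans (le_ciSup hbdd i), ciSup_le fun i => (abs_le.1 (h i)).2⟩

lemma abs_ciSup_sub_ciSup_le {f g : ι → ℝ} {C : ℝ} (hf : BddAbove (Set.range f))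
    (hg : BddAbove (Set.range g)) (h : ∀ i, |f i - g i| ≤ C) : |(⨆ i, f i) - ⨆ i, g i| ≤ C := by
  have hfg : ⨆ i, f i ≤ (⨆ i, g i) + C := ciSup_le fun i => by
    linarith [le_ciSup hg i, (abs_le.1 (h i)).2]
  have hgf : ⨆ i, g i ≤ (⨆ i, f i) + C := ciSup_le fun i => by
    linarith [le_ciSup hf i, (abs_le.1 (h i)).1]
  exact abs_le.2 ⟨by linarith, by linarith⟩

lemma integrable_ciSup_of_finite {Ω : Type*} [MeasurableSpace Ω] {P : Measure Ω} [Finite ι]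
    {f : ι → Ω → ℝ} (hf : ∀ i, Integrable (f i) P) : Integrable (fun ω => ⨆ i, f i ω) P := by
  have := Fintype.ofFinite ι
  refine Integrable.mono' (integrable_finsetSum Finset.univ fun i _ => (hf i).abs)
    (AEMeasurable.iSup fun i => (hf i).aemeasurable).aestronglyMeasurable (ae_of_all _ fun ω => ?_)
  exact abs_ciSup_le fun i =>
    Finset.single_le_sum (f := fun i => |f i ω|) (fun j _ => abs_nonneg _) (Finset.mem_univ i)

end Suprema

section ExtendedReal

lemma coe_sum_eq_sum_coe {ι : Type*} (s : Finset ι) (f : ι → ℝ) :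
    ((∑ i ∈ s, f i : ℝ) : EReal) = ∑ i ∈ s, (f i : EReal) :=
  map_sum (⟨⟨Real.toEReal, EReal.coe_zero⟩, EReal.coe_add⟩ : ℝ →+ EReal) f s

lemma coe_mul_sum_of_nonneg {ι : Type*} (s : Finset ι) {c : ℝ} (hc : 0 ≤ c) {f : ι → EReal} :
    (c : EReal) * ∑ i ∈ s, f i = ∑ i ∈ s, (c : EReal) * f i :=
  map_sum (⟨⟨fun x => (c : EReal) * x, mul_zero _⟩, fun _ _ =>
    EReal.left_distrib_of_nonneg_of_ne_top (EReal.coe_nonneg.2 hc) (EReal.coe_ne_top c) _ _⟩ :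
      EReal →+ EReal) f s

lemma ofReal_integral_le_mul_lintegral {α : Type*} [MeasurableSpace α] {P : Measure α}
    {f g : α → ℝ} {c : ℝ} (hf : Integrable f P) (hc : 0 ≤ c) (hfg : ∀ x, f x ≤ c * g x) :
    ENNReal.ofReal (∫ x, f x ∂P) ≤ ENNReal.ofReal c * ∫⁻ x, ENNReal.ofReal (g x) ∂P := by
  calc ENNReal.ofReal (∫ x, f x ∂P) ≤ ∫⁻ x, ENNReal.ofReal (f x) ∂P := by
        refine (ENNReal.ofReal_le_ofReal ?_).trans ENNReal.ofReal_toReal_le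
        rw [integral_eq_lintegral_pos_part_sub_lintegral_neg_part hf]
        exact sub_le_self _ ENNReal.toReal_nonneg
    _ ≤ ∫⁻ x, ENNReal.ofReal c * ENNReal.ofReal (g x) ∂P := lintegral_mono fun x => by
        rw [← ENNReal.ofReal_mul hc]
        exact ENNReal.ofReal_le_ofReal (hfg x)
    _ = _ := lintegral_const_mul' _ _ ENNReal.ofReal_ne_top

end ExtendedReal

section Bounds

lemma sum_norm_le_sqrt_mul {n : ℕ} {E : Type*} [SeminormedAddCommGroup E] (a : Fin n → E) :
    ∑ i, ‖a i‖ ≤ √n * √(∑ i, ‖a i‖ ^ 2) := by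
  rw [← Real.sqrt_mul n.cast_nonneg]
  refine Real.le_sqrt_of_sq_le ?_
  simpa using sq_sum_le_card_mul_sum_sq (s := Finset.univ) (f := fun i => ‖a i‖)

lemma two_mul_sqrt_pi_div_two : 2 * √(Real.pi / 2) = √(2 * Real.pi) := by
  rw [show 2 * Real.pi = 2 ^ 2 * (Real.pi / 2) by ring, Real.sqrt_mul (by norm_num),
    Real.sqrt_sq two_pos.le]

lemma exp_neg_two_mul_sq_div_le {T : ℕ} [NeZero T] {c ε δ : ℝ} (hc : 0 < c) (hδ : 0 < δ)
    (hε : c ^ 2 * Real.log (1 / δ) ≤ 2 * T * ε ^ 2) :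
    Real.exp (-2 * (T * ε) ^ 2 / (T * c ^ 2)) ≤ δ := by
  have hT : (T : ℝ) ≠ 0 := NeZero.ne _
  rw [← Real.le_log_iff_exp_le hδ, ← neg_le_neg_iff, ← Real.log_inv, ← one_div]
  refine ((le_div_iff₀' (by positivity)).2 hε).trans_eq ?_
  field_simp

lemma mul_log_one_div_le_two_mul_sq_sqrt {t a c c' x δ : ℝ} (hδ : δ ∈ Set.Ioo (0 : ℝ) 1)
    (ha : 1 ≤ a) (hc : 0 ≤ c) (hcc' : c ≤ c') (ht : 0 < t)
    (hx : 2 * t * x = c' * Real.log (a / δ)) : c * Real.log (1 / δ) ≤ 2 * t * √x ^ 2 := by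
  have hlog : 0 ≤ Real.log (1 / δ) := Real.log_nonneg ((one_le_div hδ.1).2 hδ.2.le)
  have hlog' : Real.log (1 / δ) ≤ Real.log (a / δ) := by
    have := hδ.1
    gcongr
  have hle : c * Real.log (1 / δ) ≤ 2 * t * x := by
    rw [hx]
    exact mul_le_mul hcc' hlog' hlog (hc.trans hcc')
  have hx_nonneg : 0 ≤ x :=
    nonneg_of_mul_nonneg_right ((mul_nonneg hc hlog).trans hle) (by positivity)
  rwa [Real.sq_sqrt hx_nonneg]

end Bounds

section ProductMeasure

lemma integral_comp_measurePreserving {Ω Ω' : Type*} [MeasurableSpace Ω] [MeasurableSpace Ω']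
    {μ : Measure Ω} {ν : Measure Ω'} {φ : Ω → Ω'} (hφ : MeasurePreserving φ μ ν) {f : Ω' → ℝ}
    (hf : AEStronglyMeasurable f ν) : ∫ ω, f (φ ω) ∂μ = ∫ ω', f ω' ∂ν := by
  rw [← hφ.map_eq] at hf ⊢
  exact (integral_map hφ.aemeasurable hf).symm

lemma measurePreserving_cons {n : ℕ} {Ω : Fin (n + 1) → Type*} [∀ i, MeasurableSpace (Ω i)]
    (P : ∀ i, Measure (Ω i)) [∀ i, SigmaFinite (P i)] :
    MeasurePreserving (fun p : Ω 0 × (∀ i : Fin n, Ω i.succ) => Fin.cons (α := Ω) p.1 p.2)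
      ((P 0).prod (Measure.pi fun i : Fin n => P i.succ)) (Measure.pi P) := by
  have hcons : (fun p : Ω 0 × (∀ i : Fin n, Ω i.succ) => Fin.cons (α := Ω) p.1 p.2)
      = (MeasurableEquiv.piFinSuccAbove Ω 0).symm := by
    ext p i
    exact Fin.cases rfl (fun _ => rfl) i
  rw [hcons]
  exact (measurePreserving_piFinSuccAbove P 0).symm

end ProductMeasure

section Normal

variable {ι : Type*} [Fintype ι]

instance (v : ℝ≥0) : (gaussianReal 0 v).IsNegInvariant :=
  ⟨by simpa [Measure.neg] using gaussianReal_map_neg (μ := 0) (v := v)⟩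

instance : IsProbabilityMeasure (stdNormal ι) := by
  unfold stdNormal; infer_instance

instance : (stdNormal ι).IsNegInvariant := by
  unfold stdNormal; infer_instance

lemma integrable_sum_stdNormal (v : ι → ℝ) :
    Integrable (fun γ : ι → ℝ => ∑ i, γ i * v i) (stdNormal ι) :=
  integrable_finsetSum _ fun i _ =>
    (integrable_eval (μ := fun _ : ι => gaussianReal 0 1) (i := i)
      IsGaussian.integrable_id).mul_const _

lemma integral_abs_gaussianReal : ∫ x, |x| ∂(gaussianReal 0 1) = √(2 / Real.pi) := by
  have hpdf (x : ℝ) : gaussianPDFReal 0 1 x • |x|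
      = (√(2 * Real.pi))⁻¹ * (|x| ^ (1 : ℝ) * Real.exp (-(1 / 2) * |x| ^ (2 : ℝ))) := by
    rw [gaussianPDFReal, NNReal.coe_one, sub_zero, mul_one, mul_one, smul_eq_mul, Real.rpow_one,
      Real.rpow_two, sq_abs]
    ring_nf
  simp_rw [integral_gaussianReal_eq_integral_smul one_ne_zero, hpdf]
  rw [integral_comp_abs (f := fun y => (√(2 * Real.pi))⁻¹ *
    (y ^ (1 : ℝ) * Real.exp (-(1 / 2) * y ^ (2 : ℝ)))), integral_const_mul,
    integral_rpow_mul_exp_neg_mul_rpow (by norm_num) (by norm_num) (by norm_num)]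
  norm_num [Real.Gamma_one]
  have := Real.sqrt_pos.2 Real.pi_pos
  have h2 : √2 * √2 = 2 := Real.mul_self_sqrt (by norm_num)
  field_simp
  linarith

lemma map_sum_stdNormal (v : ι → ℝ) :
    (stdNormal ι).map (fun γ => ∑ i, γ i * v i)
      = (gaussianReal 0 1).map (fun x => √(∑ i, v i ^ 2) * x) := by
  have h := IsGaussian.map_eq_gaussianReal (μ := stdGaussian (EuclideanSpace ℝ ι))
    (innerSL ℝ (WithLp.toLp 2 v))
  rw [variance_dual_stdGaussian, integral_strongDual_stdGaussian, ← map_pi_eq_stdGaussian,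
    Measure.map_map (by fun_prop) (by fun_prop)] at h
  have hinner : (innerSL ℝ (WithLp.toLp 2 v) : EuclideanSpace ℝ ι → ℝ) ∘ WithLp.toLp 2
      = fun γ => ∑ i, γ i * v i := by
    ext γ
    simp [PiLp.inner_apply]
  have hv : 0 ≤ ∑ i, v i ^ 2 := by positivity
  rw [stdNormal, ← hinner, h, gaussianReal_map_const_mul]
  congr 1
  · simp
  · exact NNReal.eq (by simp [EuclideanSpace.norm_sq_eq, Real.sq_sqrt hv, hv])

lemma integral_abs_sum_stdNormal (v : ι → ℝ) :
    √(Real.pi / 2) * ∫ γ, |∑ i, γ i * v i| ∂(stdNormal ι) = √(∑ i, v i ^ 2) := by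
  rw [← integral_map (φ := fun γ : ι → ℝ => ∑ i, γ i * v i) (f := fun x => |x|)
    (integrable_sum_stdNormal v).aemeasurable (by fun_prop), map_sum_stdNormal,
    integral_map (by fun_prop) (by fun_prop)]
  simp only [abs_mul, abs_of_nonneg (Real.sqrt_nonneg _)]
  rw [integral_const_mul, integral_abs_gaussianReal, mul_left_comm,
    ← Real.sqrt_mul (by positivity), div_mul_div_cancel₀ two_ne_zero, div_self Real.pi_ne_zero,
    Real.sqrt_one, mul_one]

lemma measurePreserving_uncurry_stdNormal {κ τ : Type*} [Fintype κ] [Fintype τ]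
    (e : ι × κ ≃ τ) :
    MeasurePreserving (fun (γ : ι → κ → ℝ) (p : τ) => γ (e.symm p).1 (e.symm p).2)
      (Measure.pi fun _ : ι => stdNormal κ) (stdNormal τ) := by
  have hm : Measurable (fun (γ : ι → κ → ℝ) (p : τ) => γ (e.symm p).1 (e.symm p).2) := by fun_prop
  refine ⟨hm, (Measure.pi_eq fun s hs => ?_).symm⟩
  have hpre : (fun (γ : ι → κ → ℝ) (p : τ) => γ (e.symm p).1 (e.symm p).2) ⁻¹' Set.univ.pi s
      = Set.univ.pi fun i => Set.univ.pi fun k => s (e (i, k)) := by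
    ext γ
    simp only [Set.mem_preimage, Set.mem_univ_pi]
    exact ⟨fun h i k => by simpa using h (e (i, k)),
      fun h p => by simpa using h (e.symm p).1 (e.symm p).2⟩
  rw [Measure.map_apply hm (MeasurableSet.univ_pi hs), hpre, Measure.pi_pi]
  simp_rw [stdNormal, Measure.pi_pi]
  rw [← Fintype.prod_prod_type', ← e.symm.prod_comp]
  simp

end Normal

section Rademacher

variable {ι : Type*} {n : ℕ}

/-- The supremum `sup_i ∑ t, σ t * a i t` of a family of vectors in the direction of a sign vector.
Signs are encoded as units of `ℤ`. -/
def signedSup (σ : Fin n → ℤˣ) (a : ι → Fin n → ℝ) : ℝ :=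
  ⨆ i, ∑ t, σ t • a i t

/-- The Rademacher average `𝔼 sup_i ∑ t, σ t * a i t` of a family of vectors, over independent
uniform signs `σ t`. -/
def radAvg (a : ι → Fin n → ℝ) : ℝ :=
  𝔼 σ, signedSup σ a

lemma abs_sum_signs_smul_le (σ : Fin n → ℤˣ) (a : Fin n → ℝ) :
    |∑ t, σ t • a t| ≤ ∑ t, |a t| := by
  refine (Finset.abs_sum_le_sum_abs _ _).trans (Finset.sum_le_sum fun t _ => ?_)
  rcases Int.units_eq_one_or (σ t) with h | h <;> simp [h]

lemma bddAbove_sum_signs_smul {a : ι → Fin n → ℝ} {B : ℝ} (ha : ∀ i t, |a i t| ≤ B)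
    (σ : Fin n → ℤˣ) : BddAbove (Set.range fun i => ∑ t, σ t • a i t) := by
  refine ⟨∑ _t : Fin n, B, Set.forall_mem_range.2 fun i => ?_⟩
  exact ((le_abs_self _).trans (abs_sum_signs_smul_le σ (a i))).trans
    (Finset.sum_le_sum fun t _ => ha i t)

lemma le_signedSup {a : ι → Fin n → ℝ} {B : ℝ} (ha : ∀ i t, |a i t| ≤ B) (σ : Fin n → ℤˣ)
    (i : ι) : ∑ t, σ t • a i t ≤ signedSup σ a :=
  le_ciSup (bddAbove_sum_signs_smul ha σ) i

lemma abs_signedSup_le [Nonempty ι] {a : ι → Fin n → ℝ} {B : ℝ} (ha : ∀ i t, |a i t| ≤ B)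
    (σ : Fin n → ℤˣ) : |signedSup σ a| ≤ n * B := by
  refine abs_ciSup_le fun i => (abs_sum_signs_smul_le σ (a i)).trans ?_
  simpa using Finset.sum_le_sum fun t (_ : t ∈ Finset.univ) => ha i t

lemma abs_signedSup_sub_signedSup_le [Nonempty ι] {a a' : ι → Fin n → ℝ} {B C : ℝ}
    (ha : ∀ i t, |a i t| ≤ B) (ha' : ∀ i t, |a' i t| ≤ B)
    (h : ∀ i, ∑ t, |a i t - a' i t| ≤ C) (σ : Fin n → ℤˣ) :
    |signedSup σ a - signedSup σ a'| ≤ C :=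
  abs_ciSup_sub_ciSup_le (bddAbove_sum_signs_smul ha σ) (bddAbove_sum_signs_smul ha' σ) fun i => by
    simpa only [← Finset.sum_sub_distrib, ← smul_sub] using
      (abs_sum_signs_smul_le σ fun t => a i t - a' i t).trans (h i)

lemma signedSup_sub_le [Nonempty ι] {a a' : ι → Fin n → ℝ} {B : ℝ} (ha : ∀ i t, |a i t| ≤ B)
    (ha' : ∀ i t, |a' i t| ≤ B) (σ : Fin n → ℤˣ) :
    signedSup σ (fun i t => a i t - a' i t) ≤ signedSup σ a + signedSup (-σ) a' :=
  ciSup_le fun i => by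
    simpa [smul_sub, Units.neg_smul, sub_eq_add_neg, Finset.sum_add_distrib] using
      add_le_add (le_signedSup ha σ i) (le_signedSup ha' (-σ) i)

lemma measurable_signedSup {Ω : Type*} [MeasurableSpace Ω] [Countable ι] {a : ι → Fin n → Ω → ℝ}
    (ha : ∀ i t, Measurable (a i t)) (σ : Fin n → ℤˣ) :
    Measurable fun ω => signedSup σ fun i t => a i t ω :=
  Measurable.iSup fun i => Finset.measurable_sum _ fun t _ => by
    simpa [Units.smul_def] using (ha i t).const_mul _

lemma abs_radAvg_le [Nonempty ι] {a : ι → Fin n → ℝ} {B : ℝ} (ha : ∀ i t, |a i t| ≤ B) :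
    |radAvg a| ≤ n * B :=
  (Finset.abs_expect_le _ _).trans
    (Finset.expect_le Finset.univ_nonempty fun σ _ => abs_signedSup_le ha σ)

lemma abs_radAvg_sub_radAvg_le [Nonempty ι] {a a' : ι → Fin n → ℝ} {B C : ℝ}
    (ha : ∀ i t, |a i t| ≤ B) (ha' : ∀ i t, |a' i t| ≤ B)
    (h : ∀ i, ∑ t, |a i t - a' i t| ≤ C) : |radAvg a - radAvg a'| ≤ C := by
  rw [radAvg, radAvg, ← Finset.expect_sub_distrib]
  exact (Finset.abs_expect_le _ _).trans
    (Finset.expect_le Finset.univ_nonempty fun σ _ => abs_signedSup_sub_signedSup_le ha ha' h σ)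

lemma measurable_radAvg {Ω : Type*} [MeasurableSpace Ω] [Countable ι] {a : ι → Fin n → Ω → ℝ}
    (ha : ∀ i t, Measurable (a i t)) : Measurable fun ω => radAvg fun i t => a i t ω := by
  simp_rw [radAvg, Fintype.expect_eq_sum_div_card]
  exact (Finset.measurable_sum _ fun σ _ => measurable_signedSup ha σ).div_const _

lemma expect_signs_succ (f : (Fin (n + 1) → ℤˣ) → ℝ) :
    𝔼 σ, f σ =
      2⁻¹ * (𝔼 σ : Fin n → ℤˣ, f (Fin.cons 1 σ) + 𝔼 σ : Fin n → ℤˣ, f (Fin.cons (-1) σ)) := by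
  rw [← Fintype.expect_equiv (Fin.consEquiv fun _ => ℤˣ) (fun p => f (Fin.cons p.1 p.2)) f
    fun _ => rfl, ← Finset.univ_product_univ, Finset.expect_product,
    Fintype.expect_eq_sum_div_card (ι := ℤˣ)]
  simp [UnitsInt.univ]
  ring

end Rademacher

section Contraction

variable {ι Ω : Type*} [MeasurableSpace Ω] {P : Measure Ω} [IsProbabilityMeasure P]

lemma half_ciSup_add_ciSup_le_integral [Finite ι] [Nonempty ι] [AddGroup Ω] [MeasurableNeg Ω]
    [P.IsNegInvariant] {ξ : ι → Ω → ℝ} (hodd : ∀ i, (ξ i).Odd) (hint : ∀ i, Integrable (ξ i) P)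
    {ψ : ι → ℝ} (h : ∀ i j, |ψ i - ψ j| ≤ ∫ ω, |ξ i ω - ξ j ω| ∂P) (g : ι → ℝ) :
    2⁻¹ * ((⨆ i, (ψ i + g i)) + ⨆ i, (-ψ i + g i)) ≤ ∫ ω, ⨆ i, (ξ i ω + g i) ∂P := by
  obtain ⟨i, hi⟩ := exists_eq_ciSup_of_finite (f := fun i => ψ i + g i)
  obtain ⟨j, hj⟩ := exists_eq_ciSup_of_finite (f := fun i => -ψ i + g i)
  set M : Ω → ℝ := fun ω => ⨆ i, (ξ i ω + g i)
  have hM : Integrable M P := integrable_ciSup_of_finite fun i => (hint i).add (integrable_const _)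
  have hle (ω i) : ξ i ω + g i ≤ M ω :=
    le_ciSup (f := fun i => ξ i ω + g i) (Set.finite_range _).bddAbove i
  have hpt (ω) : |ξ i ω - ξ j ω| + (g i + g j) ≤ M ω + M (-ω) := by
    have hi' := hle (-ω) i
    have hj' := hle (-ω) j
    rw [hodd] at hi' hj'
    rcases abs_cases (ξ i ω - ξ j ω) with h | h <;> linarith [hle ω i, hle ω j]
  have hdiff : Integrable (fun ω => |ξ i ω - ξ j ω|) P := ((hint i).sub (hint j)).abs
  have hmono := integral_mono (hdiff.add (integrable_const (g i + g j))) (hM.add hM.comp_neg) hpt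
  simp only [Pi.add_apply] at hmono
  rw [integral_add hM hM.comp_neg, integral_neg_eq_self M P,
    integral_add hdiff (integrable_const _), integral_const, probReal_univ, one_smul] at hmono
  rw [← hi, ← hj]
  linarith [(le_abs_self _).trans (h i j)]

lemma integrable_ciSup_sum_eval [Finite ι] [Nonempty ι] {n : ℕ} {ξ : ι → Fin n → Ω → ℝ}
    (hint : ∀ i t, Integrable (ξ i t) P) (g : ι → ℝ) :
    Integrable (fun ω : Fin n → Ω => ⨆ i, (∑ t, ξ i t (ω t) + g i)) (Measure.pi fun _ => P) :=
  integrable_ciSup_of_finite fun i => (integrable_finsetSum _ fun t _ =>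
    integrable_comp_eval (μ := fun _ : Fin n => P) (hint i t)).add (integrable_const _)

-- Replacing one sign at a time by a coordinate of `ω`, the two halves of the average over that
-- sign are merged by `half_ciSup_add_ciSup_le_integral`; `g` collects the remaining terms.
lemma expect_ciSup_le_integral [Finite ι] [Nonempty ι] [AddGroup Ω] [MeasurableNeg Ω]
    [P.IsNegInvariant] {n : ℕ} {ξ : ι → Fin n → Ω → ℝ} (hodd : ∀ i t, (ξ i t).Odd)
    (hint : ∀ i t, Integrable (ξ i t) P) {ψ : ι → Fin n → ℝ}
    (h : ∀ i j t, |ψ i t - ψ j t| ≤ ∫ ω, |ξ i t ω - ξ j t ω| ∂P) (g : ι → ℝ) :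
    𝔼 σ : Fin n → ℤˣ, ⨆ i, (∑ t, σ t • ψ i t + g i) ≤
      ∫ ω, ⨆ i, (∑ t, ξ i t (ω t) + g i) ∂(Measure.pi fun _ : Fin n => P) := by
  induction n generalizing g with
  | zero => simp
  | succ n ih =>
    have hξ := integrable_ciSup_sum_eval hint g
    have hcons := measurePreserving_cons fun _ : Fin (n + 1) => P
    have hξcons : Integrable (fun p : Ω × (Fin n → Ω) => ⨆ i, (∑ t, ξ i t
        ((Fin.cons p.1 p.2 : Fin (n + 1) → Ω) t) + g i)) (P.prod (Measure.pi fun _ => P)) :=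
      hcons.integrable_comp_of_integrable hξ
    rw [← integral_comp_measurePreserving hcons hξ.aestronglyMeasurable,
      integral_prod_symm _ hξcons]
    have hsign (s : ℤˣ) : 𝔼 σ : Fin n → ℤˣ, ⨆ i, (∑ t : Fin (n + 1),
          (Fin.cons s σ : Fin (n + 1) → ℤˣ) t • ψ i t + g i)
        ≤ ∫ ω, ⨆ i, (∑ t, ξ i t.succ (ω t) + (s • ψ i 0 + g i))
          ∂(Measure.pi fun _ : Fin n => P) := by
      simpa only [Fin.sum_univ_succ, Fin.cons_zero, Fin.cons_succ, add_assoc, add_left_comm] using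
        ih (fun i t => hodd i t.succ) (fun i t => hint i t.succ) (fun i j t => h i j t.succ)
          fun i => s • ψ i 0 + g i
    have htail (s : ℤˣ) := integrable_ciSup_sum_eval (fun i (t : Fin n) => hint i t.succ)
      fun i => s • ψ i 0 + g i
    rw [expect_signs_succ]
    refine (mul_le_mul_of_nonneg_left (add_le_add (hsign 1) (hsign (-1))) (by norm_num)).trans ?_
    rw [← integral_add (htail 1) (htail (-1)), ← integral_const_mul]
    refine integral_mono (((htail 1).add (htail (-1))).const_mul _) hξcons.integral_prod_right
      fun ω => ?_
    simpa [Fin.sum_univ_succ, add_assoc, add_left_comm] using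
      half_ciSup_add_ciSup_le_integral (fun i => hodd i 0) (fun i => hint i 0)
        (fun i j => h i j 0) fun i => ∑ t, ξ i t.succ (ω t) + g i

end Contraction

section ExtendedExpectation

variable {Ω : Type*} [MeasurableSpace Ω] {P : Measure Ω}

lemma eexpect_mono {g g' : Ω → EReal} (h : ∀ ω, g ω ≤ g' ω) : eexpect P g ≤ eexpect P g' := by
  refine EReal.sub_le_sub ?_ ?_ <;> rw [EReal.coe_ennreal_le_coe_ennreal_iff] <;>
    refine lintegral_mono fun ω => EReal.toENNReal_le_toENNReal ?_
  · exact h ω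
  · exact EReal.neg_le_neg_iff.2 (h ω)

lemma eexpect_coe {f : Ω → ℝ} (hf : Integrable f P) :
    eexpect P (fun ω => (f ω : EReal)) = ((∫ ω, f ω ∂P : ℝ) : EReal) := by
  have hpos : ∫⁻ ω, ENNReal.ofReal (f ω) ∂P ≠ ⊤ := hf.lintegral_lt_top.ne
  have hneg : ∫⁻ ω, ENNReal.ofReal (-f ω) ∂P ≠ ⊤ := hf.neg.lintegral_lt_top.ne
  simp only [eexpect, ← EReal.coe_neg, EReal.real_coe_toENNReal]
  rw [integral_eq_lintegral_pos_part_sub_lintegral_neg_part hf, EReal.coe_sub,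
    EReal.coe_ennreal_toReal hpos, EReal.coe_ennreal_toReal hneg]

end ExtendedExpectation

section GaussianComparison

variable {ι κ τ : Type*} [Fintype κ] [Fintype τ] {n : ℕ}

lemma integral_ciSup_le_gaussAvg [Finite ι] [Nonempty ι] {φ : ι → τ → ℝ} {Y : Set (τ → ℝ)}
    (h : ∀ i, φ i ∈ Y) :
    ((∫ γ, ⨆ i, ∑ p, γ p * φ i p ∂(stdNormal τ) : ℝ) : EReal) ≤ gaussAvg Y := by
  rw [← eexpect_coe (integrable_ciSup_of_finite fun i => integrable_sum_stdNormal (φ i))]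
  refine eexpect_mono fun γ => ?_
  obtain ⟨i, hi⟩ := exists_eq_ciSup_of_finite (f := fun i => ∑ p, γ p * φ i p)
  rw [← hi]
  exact le_biSup (fun y : τ → ℝ => ((∑ p, γ p * y p : ℝ) : EReal)) (h i)

lemma gaussAvg_nonneg {Y : Set (τ → ℝ)} (h : Y.Nonempty) : 0 ≤ gaussAvg Y := by
  obtain ⟨y, hy⟩ := h
  have hcentred : ∫ γ, ∑ p, γ p * y p ∂(stdNormal τ) = 0 := by
    have hneg := integral_neg_eq_self (fun γ => ∑ p, γ p * y p) (stdNormal τ)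
    simp only [Pi.neg_apply, neg_mul, Finset.sum_neg_distrib, integral_neg] at hneg
    linarith
  simpa [hcentred] using integral_ciSup_le_gaussAvg (φ := fun _ : Unit => y) fun _ => hy

lemma radAvg_le_integral_stdNormal [Finite ι] [Nonempty ι] (e : Fin n × κ ≃ τ)
    (ψ : ι → Fin n → ℝ) (φ : ι → τ → ℝ) {b : ℝ} (hb : 0 ≤ b)
    (h : ∀ i j t, |ψ i t - ψ j t| ≤ b * √(∑ k, (φ i (e (t, k)) - φ j (e (t, k))) ^ 2)) :
    radAvg ψ ≤ √(Real.pi / 2) * b * ∫ γ, ⨆ i, ∑ p, γ p * φ i p ∂(stdNormal τ) := by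
  set c := √(Real.pi / 2) * b
  have hc : 0 ≤ c := by positivity
  let ξ : ι → Fin n → (κ → ℝ) → ℝ := fun i t γ => c * ∑ k, γ k * φ i (e (t, k))
  have hodd (i t) : (ξ i t).Odd := fun γ => by simp [ξ]
  have hint (i t) : Integrable (ξ i t) (stdNormal κ) := (integrable_sum_stdNormal _).const_mul c
  have hincr (i j t) : |ψ i t - ψ j t| ≤ ∫ γ, |ξ i t γ - ξ j t γ| ∂(stdNormal κ) := by
    refine (h i j t).trans (le_of_eq ?_)
    simp only [ξ, ← mul_sub, ← Finset.sum_sub_distrib, abs_mul, abs_of_nonneg hc]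
    rw [integral_const_mul, ← integral_abs_sum_stdNormal]
    ring
  have hreindex (γ : Fin n → κ → ℝ) (i) :
      ∑ t, ξ i t (γ t) = c * ∑ p, γ (e.symm p).1 (e.symm p).2 * φ i p := by
    rw [← e.sum_comp, Fintype.sum_prod_type]
    simp [ξ, Finset.mul_sum]
  have hsup : Integrable (fun γ => ⨆ i, ∑ p, γ p * φ i p) (stdNormal τ) :=
    integrable_ciSup_of_finite fun i => integrable_sum_stdNormal (φ i)
  have key := expect_ciSup_le_integral hodd hint hincr 0
  simp only [Pi.zero_apply, add_zero, hreindex, ← Real.mul_iSup_of_nonneg hc] at key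
  rwa [integral_const_mul, integral_comp_measurePreserving (measurePreserving_uncurry_stdNormal e)
    hsup.aestronglyMeasurable] at key

-- An arbitrary bounded family is approximated by one near-maximizer for each choice of signs.
lemma radAvg_le_gaussAvg [Nonempty ι] (e : Fin n × κ ≃ τ) (ψ : ι → Fin n → ℝ) (φ : ι → τ → ℝ)
    {Y : Set (τ → ℝ)} (hY : ∀ i, φ i ∈ Y) {C : ℝ} (hψ : ∀ i t, |ψ i t| ≤ C) {b : ℝ} (hb : 0 ≤ b)
    (h : ∀ i j t, |ψ i t - ψ j t| ≤ b * √(∑ k, (φ i (e (t, k)) - φ j (e (t, k))) ^ 2)) :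
    ((radAvg ψ : ℝ) : EReal) ≤ ((√(Real.pi / 2) * b : ℝ) : EReal) * gaussAvg Y := by
  refine EReal.ge_of_forall_gt_iff_ge.1 fun (z : ℝ) hz => ?_
  have hε : 0 < radAvg ψ - z := sub_pos.2 (EReal.coe_lt_coe_iff.1 hz)
  have hmax (σ : Fin n → ℤˣ) : ∃ i, signedSup σ ψ - (radAvg ψ - z) < ∑ t, σ t • ψ i t :=
    exists_lt_of_lt_ciSup (by rw [← signedSup]; linarith)
  choose s hs using hmax
  have hfinite : radAvg ψ ≤ radAvg (fun σ => ψ (s σ)) + (radAvg ψ - z) := by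
    calc radAvg ψ ≤ 𝔼 σ, (signedSup σ (fun σ => ψ (s σ)) + (radAvg ψ - z)) :=
          Finset.expect_le_expect fun σ _ => by
            linarith [hs σ, le_signedSup (fun σ t => hψ (s σ) t) σ σ]
      _ = radAvg (fun σ => ψ (s σ)) + (radAvg ψ - z) := by
          rw [Finset.expect_add_distrib, Fintype.expect_const]; rfl
  have hgauss := radAvg_le_integral_stdNormal e (fun σ => ψ (s σ)) (fun σ => φ (s σ)) hb
    fun i j t => h _ _ t
  refine (EReal.coe_le_coe_iff.2 ((by linarith : z ≤ _).trans hgauss)).trans ?_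
  rw [EReal.coe_mul]
  exact mul_le_mul_of_nonneg_left (integral_ciSup_le_gaussAvg fun σ => hY _)
    (by exact_mod_cast (by positivity : 0 ≤ √(Real.pi / 2) * b))

end GaussianComparison

section Symmetrization

variable {Ω ι : Type*} [MeasurableSpace Ω] {P : Measure Ω} {n : ℕ} {g : ι → Ω → ℝ} {B : ℝ}

/-- The largest cumulative deviation `sup_i ∑ t, (𝔼 g i - g i (ω t))` of a sample of length `n`
from expectation, over a family of functions. -/
def supDev (P : Measure Ω) (g : ι → Ω → ℝ) (ω : Fin n → Ω) : ℝ :=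
  ⨆ i, ∑ t, (∫ x, g i x ∂P - g i (ω t))

lemma supDev_eq_signedSup (ω : Fin n → Ω) :
    supDev P g ω = signedSup 1 fun i t => ∫ x, g i x ∂P - g i (ω t) := by
  simp [supDev, signedSup]

lemma measurable_signedSup_comp [Countable ι] (hg : ∀ i, Measurable (g i)) (σ : Fin n → ℤˣ) :
    Measurable fun ω : Fin n → Ω => signedSup σ fun i t => g i (ω t) :=
  measurable_signedSup (fun i t => (hg i).comp (measurable_pi_apply t)) σ

lemma integrable_signedSup_comp [Countable ι] [Nonempty ι] (hg : ∀ i, Measurable (g i))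
    (hB : ∀ i x, |g i x| ≤ B) (σ : Fin n → ℤˣ) {Q : Measure (Fin n → Ω)} [IsFiniteMeasure Q] :
    Integrable (fun ω => signedSup σ fun i t => g i (ω t)) Q :=
  Integrable.of_bound (measurable_signedSup_comp hg σ).aestronglyMeasurable (n * B)
    (ae_of_all _ fun ω => abs_signedSup_le (fun i t => hB i (ω t)) σ)

lemma integrable_radAvg_comp [Countable ι] [Nonempty ι] (hg : ∀ i, Measurable (g i))
    (hB : ∀ i x, |g i x| ≤ B) {Q : Measure (Fin n → Ω)} [IsFiniteMeasure Q] :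
    Integrable (fun ω => radAvg fun i t => g i (ω t)) Q := by
  simp_rw [radAvg, Fintype.expect_eq_sum_div_card]
  exact (integrable_finsetSum _ fun σ _ => integrable_signedSup_comp hg hB σ).div_const _

lemma integral_radAvg_comp [Countable ι] [Nonempty ι] (hg : ∀ i, Measurable (g i))
    (hB : ∀ i x, |g i x| ≤ B) {Q : Measure (Fin n → Ω)} [IsFiniteMeasure Q] :
    ∫ ω, radAvg (fun i t => g i (ω t)) ∂Q = 𝔼 σ, ∫ ω, signedSup σ (fun i t => g i (ω t)) ∂Q := by
  simp_rw [radAvg, Fintype.expect_eq_sum_div_card]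
  rw [integral_div, integral_finsetSum _ fun σ _ => integrable_signedSup_comp hg hB σ]

variable [IsProbabilityMeasure P]

lemma abs_integral_sub_le {f : Ω → ℝ} (hf : ∀ x, |f x| ≤ B) (y : Ω) :
    |∫ x, f x ∂P - f y| ≤ 2 * B := by
  have hint : |∫ x, f x ∂P| ≤ B := by
    simpa using norm_integral_le_of_norm_le_const (μ := P) (f := f) (ae_of_all _ hf)
  exact (abs_sub _ _).trans (by linarith [hf y])

lemma le_supDev (hB : ∀ i x, |g i x| ≤ B) (ω : Fin n → Ω) (i : ι) :
    ∑ t, (∫ x, g i x ∂P - g i (ω t)) ≤ supDev P g ω := by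
  rw [supDev_eq_signedSup]
  simpa using le_signedSup (fun i t => abs_integral_sub_le (P := P) (hB i) (ω t)) 1 i

lemma integrable_supDev [Countable ι] [Nonempty ι] (hg : ∀ i, Measurable (g i))
    (hB : ∀ i x, |g i x| ≤ B) {Q : Measure (Fin n → Ω)} [IsFiniteMeasure Q] :
    Integrable (supDev P g) Q := by
  simp_rw [funext (supDev_eq_signedSup (P := P) (g := g))]
  exact integrable_signedSup_comp (fun i => (hg i).const_sub _)
    (fun i => abs_integral_sub_le (hB i)) 1

omit [MeasurableSpace Ω] in
lemma abs_fst_sub_snd_le (hB : ∀ i x, |g i x| ≤ B) (i : ι) (p : Ω × Ω) :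
    |g i p.1 - g i p.2| ≤ 2 * B :=
  (abs_sub _ _).trans (by linarith [hB i p.1, hB i p.2])

lemma integrable_signedSup_fst_sub_snd [Countable ι] [Nonempty ι] (hg : ∀ i, Measurable (g i))
    (hB : ∀ i x, |g i x| ≤ B) (σ : Fin n → ℤˣ) :
    Integrable (fun q : Fin n → Ω × Ω => signedSup σ fun i t => g i (q t).1 - g i (q t).2)
      (Measure.pi fun _ => P.prod P) :=
  integrable_signedSup_comp (g := fun i (p : Ω × Ω) => g i p.1 - g i p.2)
    (fun i => ((hg i).comp measurable_fst).sub ((hg i).comp measurable_snd))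
    (abs_fst_sub_snd_le hB) σ

lemma integrable_sum_eval_sub {f : Ω → ℝ} (hf : Integrable f P) (ω : Fin n → Ω) :
    Integrable (fun ω' : Fin n → Ω => ∑ t, (f (ω' t) - f (ω t))) (Measure.pi fun _ => P) :=
  integrable_finsetSum _ fun _ _ => (integrable_comp_eval hf).sub (integrable_const _)

lemma sum_integral_sub_eq_integral {f : Ω → ℝ} (hf : Integrable f P) (ω : Fin n → Ω) :
    ∑ t, (∫ x, f x ∂P - f (ω t))
      = ∫ ω' : Fin n → Ω, ∑ t, (f (ω' t) - f (ω t)) ∂(Measure.pi fun _ => P) := by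
  have hterm (t : Fin n) : Integrable (fun ω' : Fin n → Ω => f (ω' t) - f (ω t))
      (Measure.pi fun _ => P) := (integrable_comp_eval hf).sub (integrable_const _)
  rw [integral_finsetSum _ fun t _ => hterm t]
  refine Finset.sum_congr rfl fun t _ => ?_
  rw [integral_sub (integrable_comp_eval hf) (integrable_const _),
    integral_comp_eval (μ := fun _ : Fin n => P) hf.aestronglyMeasurable]
  simp

-- The first components of `q` form a ghost sample, whose expectation replaces `∫ x, g i x ∂P`.
lemma integral_supDev_le_integral_ghost [Countable ι] [Nonempty ι] (hg : ∀ i, Measurable (g i))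
    (hB : ∀ i x, |g i x| ≤ B) :
    ∫ ω : Fin n → Ω, supDev P g ω ∂(Measure.pi fun _ => P) ≤
      ∫ q, signedSup 1 (fun i t => g i (q t).1 - g i (q t).2)
        ∂(Measure.pi fun _ : Fin n => P.prod P) := by
  have hD := integrable_signedSup_fst_sub_snd (P := P) (n := n) hg hB 1
  have hsplit := (measurePreserving_arrowProdEquivProdArrow Ω Ω (Fin n)
    (fun _ => P) fun _ => P).symm
  have hS : Integrable (fun p : (Fin n → Ω) × (Fin n → Ω) =>
      signedSup 1 fun i t => g i (p.1 t) - g i (p.2 t)) _ :=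
    hsplit.integrable_comp_of_integrable hD
  refine le_of_le_of_eq ?_ ((integral_prod_symm _ hS).symm.trans
    (integral_comp_measurePreserving hsplit hD.aestronglyMeasurable))
  refine integral_mono_ae (integrable_supDev hg hB) hS.integral_prod_right ?_
  filter_upwards [hS.prod_left_ae] with ω hω
  refine ciSup_le fun i => ?_
  have hgi : Integrable (g i) P :=
    Integrable.of_bound (hg i).aestronglyMeasurable B (ae_of_all _ (hB i))
  rw [sum_integral_sub_eq_integral hgi]
  refine integral_mono (integrable_sum_eval_sub hgi ω) hω fun ω' => ?_
  simpa using le_signedSup (fun i (t : Fin n) => abs_fst_sub_snd_le hB i (ω' t, ω t)) 1 i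

lemma integral_signedSup_fst_sub_snd [Countable ι] (hg : ∀ i, Measurable (g i))
    (σ : Fin n → ℤˣ) :
    ∫ q, signedSup 1 (fun i t => g i (q t).1 - g i (q t).2)
        ∂(Measure.pi fun _ : Fin n => P.prod P)
      = ∫ q, signedSup σ (fun i t => g i (q t).1 - g i (q t).2)
        ∂(Measure.pi fun _ : Fin n => P.prod P) := by
  have hswap : MeasurePreserving
      (fun (q : Fin n → Ω × Ω) t => (if σ t = 1 then id else Prod.swap : Ω × Ω → Ω × Ω) (q t))
      (Measure.pi fun _ => P.prod P) (Measure.pi fun _ => P.prod P) :=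
    measurePreserving_pi (fun _ => P.prod P) (fun _ => P.prod P) fun t => by
      split_ifs
      exacts [MeasurePreserving.id _, Measure.measurePreserving_swap]
  rw [← integral_comp_measurePreserving hswap (measurable_signedSup_comp
    (g := fun i (p : Ω × Ω) => g i p.1 - g i p.2)
    (fun i => ((hg i).comp measurable_fst).sub ((hg i).comp measurable_snd))
    1).aestronglyMeasurable]
  refine integral_congr_ae (ae_of_all _ fun q => ?_)
  refine iSup_congr fun i => Finset.sum_congr rfl fun t _ => ?_
  rcases Int.units_eq_one_or (σ t) with h | h <;> simp [h]

lemma integral_signedSup_fst_sub_snd_le [Countable ι] [Nonempty ι] (hg : ∀ i, Measurable (g i))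
    (hB : ∀ i x, |g i x| ≤ B) (σ : Fin n → ℤˣ) :
    ∫ q, signedSup σ (fun i t => g i (q t).1 - g i (q t).2)
        ∂(Measure.pi fun _ : Fin n => P.prod P) ≤
      ∫ ω, signedSup σ (fun i t => g i (ω t)) ∂(Measure.pi fun _ : Fin n => P)
        + ∫ ω, signedSup (-σ) (fun i t => g i (ω t)) ∂(Measure.pi fun _ : Fin n => P) := by
  have hfst := measurePreserving_pi (fun _ : Fin n => P.prod P) (fun _ => P)
    fun _ => measurePreserving_fst
  have hsnd := measurePreserving_pi (fun _ : Fin n => P.prod P) (fun _ => P)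
    fun _ => measurePreserving_snd
  have hint (σ : Fin n → ℤˣ) := integrable_signedSup_comp hg hB σ
    (Q := Measure.pi fun _ : Fin n => P)
  have hint₁ : Integrable (fun q : Fin n → Ω × Ω => signedSup σ fun i t => g i (q t).1)
      (Measure.pi fun _ => P.prod P) := hfst.integrable_comp_of_integrable (hint σ)
  have hint₂ : Integrable (fun q : Fin n → Ω × Ω => signedSup (-σ) fun i t => g i (q t).2)
      (Measure.pi fun _ => P.prod P) := hsnd.integrable_comp_of_integrable (hint (-σ))
  rw [← integral_comp_measurePreserving hfst (hint σ).aestronglyMeasurable,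
    ← integral_comp_measurePreserving hsnd (hint (-σ)).aestronglyMeasurable,
    ← integral_add hint₁ hint₂]
  exact integral_mono (integrable_signedSup_fst_sub_snd hg hB σ) (hint₁.add hint₂) fun q =>
    signedSup_sub_le (fun i t => hB i _) (fun i t => hB i _) σ

theorem integral_supDev_le_two_mul_integral_radAvg [Countable ι] [Nonempty ι]
    (hg : ∀ i, Measurable (g i)) (hB : ∀ i x, |g i x| ≤ B) :
    ∫ ω : Fin n → Ω, supDev P g ω ∂(Measure.pi fun _ => P) ≤
      2 * ∫ ω : Fin n → Ω, radAvg (fun i t => g i (ω t)) ∂(Measure.pi fun _ => P) := by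
  set Q := Measure.pi fun _ : Fin n => P
  calc ∫ ω : Fin n → Ω, supDev P g ω ∂Q
      ≤ 𝔼 σ, (∫ ω, signedSup σ (fun i t => g i (ω t)) ∂Q
          + ∫ ω, signedSup (-σ) (fun i t => g i (ω t)) ∂Q) :=
        Finset.le_expect Finset.univ_nonempty fun σ _ =>
          (integral_supDev_le_integral_ghost hg hB).trans <|
            (integral_signedSup_fst_sub_snd hg σ).trans_le
              (integral_signedSup_fst_sub_snd_le hg hB σ)
    _ = 2 * ∫ ω, radAvg (fun i t => g i (ω t)) ∂Q := by
        rw [Finset.expect_add_distrib, Fintype.expect_equiv (Equiv.neg (Fin n → ℤˣ))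
          (fun σ => ∫ ω, signedSup (-σ) (fun i t => g i (ω t)) ∂Q)
          (fun σ => ∫ ω, signedSup σ (fun i t => g i (ω t)) ∂Q) fun _ => rfl,
          integral_radAvg_comp hg hB, two_mul]

end Symmetrization

section McDiarmid

lemma hasSubgaussianMGF_of_abs_sub_le {Ω : Type*} [MeasurableSpace Ω] {P : Measure Ω}
    [IsProbabilityMeasure P] {X : Ω → ℝ} (hX : Measurable X) {c : ℝ}
    (hc : ∀ x y, |X x - X y| ≤ c) :
    HasSubgaussianMGF (fun x => X x - ∫ y, X y ∂P) ((‖c‖₊ / 2) ^ 2) P := by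
  have := nonempty_of_isProbabilityMeasure P
  have hbdd : BddBelow (Set.range X) :=
    let y : Ω := Classical.arbitrary Ω
    ⟨X y - c, Set.forall_mem_range.2 fun x => by linarith [(abs_le.1 (hc y x)).2]⟩
  have hX_mem (x : Ω) : X x ∈ Set.Icc (⨅ x, X x) ((⨅ x, X x) + c) := by
    have : X x - c ≤ ⨅ x, X x := le_ciInf fun y => by linarith [(abs_le.1 (hc x y)).2]
    exact ⟨ciInf_le hbdd x, by linarith⟩
  simpa using hasSubgaussianMGF_of_mem_Icc hX.aemeasurable (ae_of_all P hX_mem)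

lemma integrable_of_abs_sub_le {Ω : Type*} [MeasurableSpace Ω] {P : Measure Ω}
    [IsProbabilityMeasure P] {X : Ω → ℝ} (hX : Measurable X) {c : ℝ}
    (hc : ∀ x y, |X x - X y| ≤ c) : Integrable X P := by
  obtain ⟨y⟩ := nonempty_of_isProbabilityMeasure P
  refine Integrable.of_bound hX.aestronglyMeasurable (|X y| + c) (ae_of_all _ fun x => ?_)
  rw [Real.norm_eq_abs]
  linarith [abs_sub_abs_le_abs_sub (X x) (X y), hc x y]

-- `exp (s * f (x, y)) = exp (s * (f (x, y) - g y)) * exp (s * g y)`; integrate `x` first.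
lemma hasSubgaussianMGF_prod {α β : Type*} [MeasurableSpace α] [MeasurableSpace β]
    {μ : Measure α} {ν : Measure β} [SFinite μ] [SFinite ν] {f : α × β → ℝ} {g : β → ℝ}
    {c d : ℝ≥0} (hf : Measurable f)
    (hfg : ∀ y, HasSubgaussianMGF (fun x => f (x, y) - g y) c μ) (hg : HasSubgaussianMGF g d ν) :
    HasSubgaussianMGF f (c + d) (μ.prod ν) := by
  have hexp (s : ℝ) (p : α × β) :
      Real.exp (s * f p) = Real.exp (s * (f p - g p.2)) * Real.exp (s * g p.2) := by
    rw [← Real.exp_add]; ring_nf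
  have hsec (s : ℝ) (y : β) : Integrable (fun x => Real.exp (s * f (x, y))) μ := by
    simp_rw [hexp s]
    exact ((hfg y).integrable_exp_mul s).mul_const _
  have hmgf (s : ℝ) (y : β) : ∫ x, Real.exp (s * f (x, y)) ∂μ
      ≤ Real.exp (c * s ^ 2 / 2) * Real.exp (s * g y) := by
    simp_rw [hexp s, integral_mul_const]
    exact mul_le_mul_of_nonneg_right ((hfg y).mgf_le s) (Real.exp_pos _).le
  have hmeas (s : ℝ) : StronglyMeasurable fun p => Real.exp (s * f p) :=
    (hf.const_mul s).exp.stronglyMeasurable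
  have hbound (s : ℝ) := (hg.integrable_exp_mul s).const_mul (Real.exp (c * s ^ 2 / 2))
  have hint (s : ℝ) : Integrable (fun p => Real.exp (s * f p)) (μ.prod ν) := by
    refine (integrable_prod_iff' (hmeas s).aestronglyMeasurable).2 ⟨ae_of_all _ (hsec s), ?_⟩
    simp only [Real.norm_eq_abs, Real.abs_exp]
    refine (hbound s).mono' (hmeas s).integral_prod_left'.aestronglyMeasurable
      (ae_of_all _ fun y => ?_)
    rw [Real.norm_of_nonneg (integral_nonneg fun _ => (Real.exp_pos _).le)]
    exact hmgf s y
  refine ⟨hint, fun s => ?_⟩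
  calc mgf f (μ.prod ν) s
      = ∫ y, ∫ x, Real.exp (s * f (x, y)) ∂μ ∂ν := integral_prod_symm _ (hint s)
    _ ≤ ∫ y, Real.exp (c * s ^ 2 / 2) * Real.exp (s * g y) ∂ν :=
        integral_mono (hint s).integral_prod_right (hbound s) (hmgf s)
    _ = Real.exp (c * s ^ 2 / 2) * mgf g ν s := integral_const_mul _ _
    _ ≤ Real.exp (c * s ^ 2 / 2) * Real.exp (d * s ^ 2 / 2) := by gcongr; exact hg.mgf_le s
    _ = Real.exp ((c + d : ℝ≥0) * s ^ 2 / 2) := by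
        rw [← Real.exp_add, NNReal.coe_add]; ring_nf

/-- The bounded differences property: changing only the coordinate `t` of the argument changes
the value of `f` by at most `c t`. -/
def BoundedDiff {n : ℕ} {Ω : Fin n → Type*} (f : (∀ i, Ω i) → ℝ) (c : Fin n → ℝ) : Prop :=
  ∀ t ω ω', (∀ s ≠ t, ω s = ω' s) → |f ω - f ω'| ≤ c t

namespace BoundedDiff

section Cons

variable {n : ℕ} {Ω : Fin (n + 1) → Type*} {f : (∀ i, Ω i) → ℝ} {c : Fin (n + 1) → ℝ}

lemma abs_cons_sub_cons_le (hf : BoundedDiff f c) (x y : Ω 0) (ω : ∀ i : Fin n, Ω i.succ) :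
    |f (Fin.cons x ω) - f (Fin.cons y ω)| ≤ c 0 :=
  hf 0 _ _ fun s hs => by
    obtain ⟨s, rfl⟩ := Fin.exists_succ_eq.2 hs
    rfl

lemma comp_cons (hf : BoundedDiff f c) (x : Ω 0) :
    BoundedDiff (fun ω : ∀ i : Fin n, Ω i.succ => f (Fin.cons x ω)) fun i => c i.succ :=
  fun t ω ω' h => hf t.succ _ _ fun s => Fin.cases (fun _ => rfl)
    (fun s hs => by simpa using h s (by simpa using hs)) s

lemma integral_cons [MeasurableSpace (Ω 0)] {P : Measure (Ω 0)} [IsProbabilityMeasure P]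
    (hf : BoundedDiff f c) (hint : ∀ ω, Integrable (fun x => f (Fin.cons x ω)) P) :
    BoundedDiff (fun ω : ∀ i : Fin n, Ω i.succ => ∫ x, f (Fin.cons x ω) ∂P) fun i => c i.succ :=
  fun t ω ω' h => by
    rw [← integral_sub (hint ω) (hint ω')]
    simpa using norm_integral_le_of_norm_le_const (μ := P)
      (f := fun x => f (Fin.cons x ω) - f (Fin.cons x ω'))
      (ae_of_all _ fun x => hf.comp_cons x t ω ω' h)

end Cons

lemma abs_sub_le {n : ℕ} {Ω : Fin n → Type*} {f : (∀ i, Ω i) → ℝ} {c : Fin n → ℝ}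
    (hf : BoundedDiff f c) (ω ω' : ∀ i, Ω i) : |f ω - f ω'| ≤ ∑ i, c i := by
  induction n with
  | zero => simp [Subsingleton.elim ω ω']
  | succ n ih =>
    rw [← Fin.cons_self_tail ω, ← Fin.cons_self_tail ω', Fin.sum_univ_succ]
    exact (_root_.abs_sub_le _ (f (Fin.cons (ω' 0) (Fin.tail ω))) _).trans
      (add_le_add (hf.abs_cons_sub_cons_le _ _ _) (ih (hf.comp_cons _) _ _))

/-- McDiarmid's inequality, by integrating out one coordinate at a time. -/
theorem hasSubgaussianMGF {n : ℕ} {Ω : Fin n → Type*} [∀ i, MeasurableSpace (Ω i)]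
    (P : ∀ i, Measure (Ω i)) [∀ i, IsProbabilityMeasure (P i)]
    {f : (∀ i, Ω i) → ℝ} {c : Fin n → ℝ} (hf : BoundedDiff f c) (hfm : Measurable f) :
    HasSubgaussianMGF (fun ω => f ω - ∫ ω', f ω' ∂(Measure.pi P)) (∑ i, (‖c i‖₊ / 2) ^ 2)
      (Measure.pi P) := by
  induction n with
  | zero =>
    have hconst (ω : ∀ i, Ω i) : f ω = f default := congrArg f (Subsingleton.elim _ _)
    simp [hconst]
  | succ n ih =>
    set g : (∀ i : Fin n, Ω i.succ) → ℝ := fun ω => ∫ x, f (Fin.cons x ω) ∂(P 0)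
    set Q := Measure.pi fun i : Fin n => P i.succ
    have hcons := measurePreserving_cons P
    have hfc : Measurable fun p : Ω 0 × (∀ i : Fin n, Ω i.succ) => f (Fin.cons p.1 p.2) :=
      hfm.comp hcons.measurable
    have hsec (ω) : Measurable fun x => f (Fin.cons x ω) := hfc.comp measurable_prodMk_right
    have hint (ω) : Integrable (fun x => f (Fin.cons x ω)) (P 0) :=
      integrable_of_abs_sub_le (hsec ω) fun x y => hf.abs_cons_sub_cons_le x y ω
    have hmean : ∫ ω, f ω ∂(Measure.pi P) = ∫ ω, g ω ∂Q :=
      (integral_comp_measurePreserving hcons hfm.aestronglyMeasurable).symm.trans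
        (integral_prod_symm _ (hcons.integrable_comp_of_integrable
          (integrable_of_abs_sub_le hfm hf.abs_sub_le)))
    have hg : HasSubgaussianMGF (fun ω => g ω - ∫ ω', g ω' ∂Q) _ Q := ih _ (hf.integral_cons hint)
      hfc.stronglyMeasurable.integral_prod_left'.measurable
    rw [hmean, Fin.sum_univ_succ]
    refine (hasSubgaussianMGF_prod (μ := P 0)
      (f := fun p => f (Fin.cons p.1 p.2) - ∫ ω, g ω ∂Q)
      (hfc.sub_const _) (fun ω => ?_) hg).congr_identDistrib ⟨?_, ?_, ?_⟩
    · simpa only [sub_sub_sub_cancel_right] using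
        hasSubgaussianMGF_of_abs_sub_le (P := P 0) (hsec ω) fun x y =>
          hf.abs_cons_sub_cons_le x y ω
    · exact (hfc.sub_const _).aemeasurable
    · exact (hfm.sub_const _).aemeasurable
    · rw [← hcons.map_eq, Measure.map_map (hfm.sub_const _) hcons.measurable]
      rfl

theorem measureReal_le_sub_integral_le {n : ℕ} {Ω : Fin n → Type*} [∀ i, MeasurableSpace (Ω i)]
    (P : ∀ i, Measure (Ω i)) [∀ i, IsProbabilityMeasure (P i)]
    {f : (∀ i, Ω i) → ℝ} {c : Fin n → ℝ} (hf : BoundedDiff f c) (hfm : Measurable f) {ε : ℝ}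
    (hε : 0 ≤ ε) :
    (Measure.pi P).real {ω | ε ≤ f ω - ∫ ω', f ω' ∂(Measure.pi P)}
      ≤ Real.exp (-2 * ε ^ 2 / ∑ i, c i ^ 2) := by
  refine ((hf.hasSubgaussianMGF P hfm).measure_ge_le hε).trans_eq (congrArg Real.exp ?_)
  have hsum : ((∑ i, (‖c i‖₊ / 2) ^ 2 : ℝ≥0) : ℝ) = (∑ i, c i ^ 2) / 4 := by
    simp only [NNReal.coe_sum, NNReal.coe_pow, NNReal.coe_div, NNReal.coe_ofNat, coe_nnnorm,
      Real.norm_eq_abs, div_pow, sq_abs, Finset.sum_div]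
    norm_num
  rw [hsum]
  ring

lemma add {n : ℕ} {Ω : Fin n → Type*} {f g : (∀ i, Ω i) → ℝ} {c d : Fin n → ℝ}
    (hf : BoundedDiff f c) (hg : BoundedDiff g d) :
    BoundedDiff (fun ω => f ω + g ω) fun i => c i + d i := fun t ω ω' h => by
  rw [add_sub_add_comm]
  exact (abs_add_le _ _).trans (add_le_add (hf t ω ω' h) (hg t ω ω' h))

lemma const_mul {n : ℕ} {Ω : Fin n → Type*} {f : (∀ i, Ω i) → ℝ} {c : Fin n → ℝ}
    (hf : BoundedDiff f c) (a : ℝ) : BoundedDiff (fun ω => a * f ω) fun i => |a| * c i :=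
  fun t ω ω' h => by
    rw [← mul_sub, abs_mul]
    exact mul_le_mul_of_nonneg_left (hf t ω ω' h) (abs_nonneg a)

end BoundedDiff

end McDiarmid

section UniformDeviation

variable {Ω ι : Type*} {n : ℕ} {g : ι → Ω → ℝ} {V : Ω → ℝ} {B c v : ℝ}

lemma sum_abs_sub_le_of_eq_off (hV : ∀ x y, |V x - V y| ≤ v) {t : Fin n} {ω ω' : Fin n → Ω}
    (h : ∀ s ≠ t, ω s = ω' s) : ∑ s, |V (ω s) - V (ω' s)| ≤ v :=
  (Finset.sum_eq_single t (fun s _ hs => by simp [h s hs]) (by simp)).trans_le (hV _ _)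

lemma boundedDiff_sum_comp (hV : ∀ x y, |V x - V y| ≤ v) :
    BoundedDiff (fun ω : Fin n → Ω => ∑ t, V (ω t)) fun _ => v := fun t ω ω' h => by
  rw [← Finset.sum_sub_distrib]
  exact (Finset.abs_sum_le_sum_abs _ _).trans (sum_abs_sub_le_of_eq_off hV h)

lemma boundedDiff_radAvg_comp [Nonempty ι] (hB : ∀ i x, |g i x| ≤ B)
    (hg_osc : ∀ i x y, |g i x - g i y| ≤ c) :
    BoundedDiff (fun ω : Fin n → Ω => radAvg fun i t => g i (ω t)) fun _ => c :=
  fun _ _ _ h => abs_radAvg_sub_radAvg_le (fun i _ => hB i _) (fun i _ => hB i _)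
    fun i => sum_abs_sub_le_of_eq_off (hg_osc i) h

variable [MeasurableSpace Ω] {P : Measure Ω} [IsProbabilityMeasure P]

lemma boundedDiff_supDev [Nonempty ι] (hB : ∀ i x, |g i x| ≤ B)
    (hg_osc : ∀ i x y, |g i x - g i y| ≤ c) :
    BoundedDiff (supDev P g : (Fin n → Ω) → ℝ) fun _ => c := fun t ω ω' h => by
  rw [supDev_eq_signedSup, supDev_eq_signedSup]
  refine abs_signedSup_sub_signedSup_le (fun i _ => abs_integral_sub_le (hB i) _)
    (fun i _ => abs_integral_sub_le (hB i) _) (fun i => ?_) 1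
  simpa only [sub_sub_sub_cancel_left, abs_sub_comm] using sum_abs_sub_le_of_eq_off (hg_osc i) h

omit [IsProbabilityMeasure P] in
lemma measurable_supDev [Countable ι] (hg : ∀ i, Measurable (g i)) :
    Measurable (supDev P g : (Fin n → Ω) → ℝ) := by
  simp_rw [funext (supDev_eq_signedSup (P := P) (g := g))]
  exact measurable_signedSup_comp (fun i => (hg i).const_sub _) 1

lemma integral_sum_comp (hV : Integrable V P) :
    ∫ ω : Fin n → Ω, ∑ t, V (ω t) ∂(Measure.pi fun _ => P) = n * ∫ x, V x ∂P := by
  rw [integral_finsetSum _ fun t _ => integrable_comp_eval hV]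
  simp [integral_comp_eval (μ := fun _ : Fin n => P) hV.aestronglyMeasurable]

lemma integral_supDev_add_radAvg_add_sum_le [Countable ι] [Nonempty ι]
    (hg : ∀ i, Measurable (g i)) (hB : ∀ i x, |g i x| ≤ B) (hV : Integrable V P) :
    ∫ ω : Fin n → Ω, (supDev P g ω + -2 * radAvg (fun i t => g i (ω t)) + -1 * ∑ t, V (ω t))
        ∂(Measure.pi fun _ => P) ≤ -(n * ∫ x, V x ∂P) := by
  have hD : Integrable (supDev P g) (Measure.pi fun _ : Fin n => P) := integrable_supDev hg hB
  have hR : Integrable (fun ω : Fin n → Ω => -2 * radAvg fun i t => g i (ω t))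
      (Measure.pi fun _ => P) := (integrable_radAvg_comp hg hB).const_mul _
  have hW : Integrable (fun ω : Fin n → Ω => -1 * ∑ t, V (ω t)) (Measure.pi fun _ => P) :=
    (integrable_finsetSum _ fun t _ => integrable_comp_eval hV).const_mul _
  have hDR : Integrable (fun ω : Fin n → Ω => supDev P g ω + -2 * radAvg fun i t => g i (ω t))
      (Measure.pi fun _ => P) := hD.add hR
  rw [integral_add hDR hW, integral_add hD hR, integral_const_mul, integral_const_mul,
    integral_sum_comp hV]
  linarith [integral_supDev_le_two_mul_integral_radAvg (P := P) (n := n) hg hB]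

theorem measureReal_le_supDev_sub_radAvg_le [Countable ι] [Nonempty ι]
    (hg : ∀ i, Measurable (g i)) (hB : ∀ i x, |g i x| ≤ B)
    (hg_osc : ∀ i x y, |g i x - g i y| ≤ c) (hV : Measurable V)
    (hV_osc : ∀ x y, |V x - V y| ≤ v) {ε : ℝ} (hε : 0 ≤ ε) :
    (Measure.pi fun _ : Fin n => P).real {ω | ε ≤ supDev P g ω
        - 2 * radAvg (fun i t => g i (ω t)) - (∑ t, V (ω t) - n * ∫ x, V x ∂P)}
      ≤ Real.exp (-2 * ε ^ 2 / (n * (3 * c + v) ^ 2)) := by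
  set Φ : (Fin n → Ω) → ℝ := fun ω =>
    supDev P g ω + -2 * radAvg (fun i t => g i (ω t)) + -1 * ∑ t, V (ω t)
  have hΦ_diff : BoundedDiff Φ fun _ => 3 * c + v := by
    convert ((boundedDiff_supDev (P := P) hB hg_osc).add
      ((boundedDiff_radAvg_comp hB hg_osc).const_mul (-2))).add
      ((boundedDiff_sum_comp hV_osc).const_mul (-1)) using 1
    ext
    norm_num
    ring
  have hΦ_meas : Measurable Φ :=
    ((measurable_supDev hg).add ((measurable_radAvg fun i t =>
      (hg i).comp (measurable_pi_apply t)).const_mul _)).add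
      ((Finset.measurable_sum _ fun t _ => hV.comp (measurable_pi_apply t)).const_mul _)
  have hΦ_mean : ∫ ω, Φ ω ∂(Measure.pi fun _ => P) ≤ -(n * ∫ x, V x ∂P) :=
    integral_supDev_add_radAvg_add_sum_le hg hB (integrable_of_abs_sub_le hV hV_osc)
  refine (measureReal_mono fun ω (hω : ε ≤ _) => ?_).trans
    ((hΦ_diff.measureReal_le_sub_integral_le _ hΦ_meas hε).trans_eq (by simp))
  rw [Set.mem_ofPred_eq]
  linarith

lemma sum_integral_sub_le_supDev_of_tendsto (hg : ∀ i, Measurable (g i))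
    (hB : ∀ i x, |g i x| ≤ B) {u : ℕ → ι} {g' : Ω → ℝ}
    (hu : ∀ x, Tendsto (fun k => g (u k) x) atTop (𝓝 (g' x))) (ω : Fin n → Ω) :
    ∑ t, (∫ x, g' x ∂P - g' (ω t)) ≤ supDev P g ω := by
  refine le_of_tendsto' (tendsto_finsetSum _ fun t _ => Tendsto.sub ?_ (hu (ω t)))
    fun k => le_supDev hB ω (u k)
  exact tendsto_integral_of_dominated_convergence (fun _ => B)
    (fun k => (hg (u k)).aestronglyMeasurable) (integrable_const _)
    (fun k => ae_of_all _ (hB (u k))) (ae_of_all _ hu)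

end UniformDeviation

section Skeleton

variable {α E : Type*} [TopologicalSpace E]

/-- `S₀` is a countable subclass of `S`, and every member of `S` is the pointwise limit of a
sequence in `S₀`. Suprema over `S₀` are measurable and replace those over `S`. -/
structure IsPointwiseSkeleton (S₀ S : Set (α → E)) : Prop where
  subset : S₀ ⊆ S
  countable : S₀.Countable
  exists_tendsto : ∀ f ∈ S, ∃ u : ℕ → S₀, ∀ x, Tendsto (fun k => (u k).1 x) atTop (𝓝 (f x))

lemma IsPointwiseSkeleton.nonempty {S₀ S : Set (α → E)} (h : IsPointwiseSkeleton S₀ S)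
    (hS : S.Nonempty) : S₀.Nonempty := by
  obtain ⟨f, hf⟩ := hS
  obtain ⟨u, -⟩ := h.exists_tendsto f hf
  exact ⟨u 0, (u 0).2⟩

lemma PointwiseSeparable.exists_isPointwiseSkeleton {X : Type*} {K : ℕ} {H : Set (X → Rep K)}
    (hH : PointwiseSeparable H) : ∃ H₀, IsPointwiseSkeleton H₀ H := by
  obtain ⟨H₀, hsub, hcount, hlim⟩ := hH
  refine ⟨H₀, hsub, hcount, fun h hh => ?_⟩
  obtain ⟨u, hu, hu_lim⟩ := hlim h hh
  exact ⟨fun k => ⟨u k, hu k⟩, hu_lim⟩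

lemma exists_isPointwiseSkeleton_of_continuous [TopologicalSpace α] [SecondCountableTopology α]
    [LocallyCompactSpace α] [SecondCountableTopology E] {S : Set (α → E)}
    (hS : ∀ f ∈ S, Continuous f) : ∃ S₀, IsPointwiseSkeleton S₀ S := by
  let C : Set C(α, E) := {φ | ⇑φ ∈ S}
  have : SecondCountableTopology C := TopologicalSpace.Subtype.secondCountableTopology C
  obtain ⟨s, hs_count, hs_dense⟩ := TopologicalSpace.exists_countable_dense C
  refine ⟨(fun φ : C => ⇑φ.1) '' s, ?_, hs_count.image _, fun f hf => ?_⟩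
  · rintro _ ⟨φ, -, rfl⟩
    exact φ.2
  · obtain ⟨φ, hφ, hlim⟩ := mem_closure_iff_seq_limit.1 (hs_dense ⟨⟨f, hS f hf⟩, hf⟩)
    refine ⟨fun k => ⟨φ k, φ k, hφ k, rfl⟩, fun x => ?_⟩
    have hcont : Continuous fun φ : C => φ.1 x :=
      (continuous_eval_const x).comp continuous_subtype_val
    exact (hcont.tendsto _).comp hlim

end Skeleton

section Loss

/-- The admissible loss functions: values in `[0, 1]`, and `1`-Lipschitz in the first argument.
Measurability is required separately in the second argument only; joint measurability follows. -/
structure IsUnitLoss (ℓ : ℝ → ℝ → ℝ) : Prop where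
  mem_Icc : ∀ u y, ℓ u y ∈ Set.Icc (0 : ℝ) 1
  lipschitz : ∀ y, LipschitzWith 1 fun u => ℓ u y
  measurable : ∀ u, Measurable (ℓ u)

namespace IsUnitLoss

variable {ℓ : ℝ → ℝ → ℝ} (hℓ : IsUnitLoss ℓ)
include hℓ

lemma nonneg (u y : ℝ) : 0 ≤ ℓ u y := (hℓ.mem_Icc u y).1

lemma abs_le_one (u y : ℝ) : |ℓ u y| ≤ 1 :=
  (abs_of_nonneg (hℓ.nonneg u y)).trans_le (hℓ.mem_Icc u y).2

lemma abs_sub_le_one (u u' y y' : ℝ) : |ℓ u y - ℓ u' y'| ≤ 1 := by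
  simpa using abs_sub_le_of_le_of_le (hℓ.nonneg u y) (hℓ.mem_Icc u y).2
    (hℓ.nonneg u' y') (hℓ.mem_Icc u' y').2

lemma abs_sub_le (u u' y : ℝ) : |ℓ u y - ℓ u' y| ≤ |u - u'| := by
  simpa [Real.dist_eq] using (hℓ.lipschitz y).dist_le_mul u u'

lemma abs_comp_sub_le {E : Type*} [SeminormedAddCommGroup E] {L : ℝ≥0} {f : E → ℝ}
    (hf : LipschitzWith L f) (v v' : E) (y : ℝ) : |ℓ (f v) y - ℓ (f v') y| ≤ L * ‖v - v'‖ :=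
  (hℓ.abs_sub_le _ _ y).trans (by simpa [Real.dist_eq, dist_eq_norm] using hf.dist_le_mul v v')

lemma measurable_uncurry : Measurable (Function.uncurry ℓ) :=
  measurable_uncurry_of_continuous_of_measurable (fun y => (hℓ.lipschitz y).continuous)
    hℓ.measurable

lemma measurable_comp {X : Type*} [MeasurableSpace X] {φ : X → ℝ} (hφ : Measurable φ) :
    Measurable fun p : Obs X => ℓ (φ p.1) p.2 :=
  hℓ.measurable_uncurry.comp ((hφ.comp measurable_fst).prodMk measurable_snd)

end IsUnitLoss

end Loss

section EmpiricalRisk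

variable {X : Type*} {n K : ℕ} {ℓ : ℝ → ℝ → ℝ} {L : ℝ≥0} {F : Set (Rep K → ℝ)}

lemma empRisk_mem_Icc (hℓ : IsUnitLoss ℓ) (f : Rep K → ℝ) (h : X → Rep K) (z : Fin n → Obs X) :
    empRisk ℓ f h z ∈ Set.Icc (0 : ℝ) 1 := by
  have hsum : ∑ i, ℓ (f (h (z i).1)) (z i).2 ≤ n :=
    (Finset.sum_le_sum fun i _ => (hℓ.mem_Icc _ _).2).trans_eq (by simp)
  rw [empRisk, one_div_mul_eq_div]
  exact ⟨div_nonneg (Finset.sum_nonneg fun i _ => hℓ.nonneg _ _) n.cast_nonneg,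
    div_le_one_of_le₀ hsum n.cast_nonneg⟩

lemma abs_empRisk_sub_le (hℓ : IsUnitLoss ℓ) {f : Rep K → ℝ} (hf : LipschitzWith L f)
    (h h' : X → Rep K) (z : Fin n → Obs X) : |empRisk ℓ f h z - empRisk ℓ f h' z|
      ≤ L / √n * blockNorm fun i => h (z i).1 - h' (z i).1 := by
  rw [empRisk, empRisk, ← mul_sub, ← Finset.sum_sub_distrib, abs_mul, abs_of_nonneg (by positivity)]
  calc 1 / (n : ℝ) * |∑ i, (ℓ (f (h (z i).1)) (z i).2 - ℓ (f (h' (z i).1)) (z i).2)|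
      ≤ 1 / n * ∑ i, L * ‖h (z i).1 - h' (z i).1‖ := by
        gcongr
        exact (Finset.abs_sum_le_sum_abs _ _).trans
          (Finset.sum_le_sum fun i _ => hℓ.abs_comp_sub_le hf _ _ _)
    _ ≤ 1 / n * (L * (√n * blockNorm fun i => h (z i).1 - h' (z i).1)) := by
        rw [← Finset.mul_sum]
        gcongr
        exact sum_norm_le_sqrt_mul _
    _ = L * (√n / n) * blockNorm fun i => h (z i).1 - h' (z i).1 := by ring
    _ = _ := by rw [Real.sqrt_div_self, div_eq_mul_inv]

namespace IsERM

variable [MeasurableSpace X] {H : Set (X → Rep K)}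
  {A : (X → Rep K) → (Fin n → Obs X) → (Rep K → ℝ)} (hA : IsERM ℓ H F A) {h h' : X → Rep K}
  (hh : h ∈ H)
include hA hh

lemma minEmpRisk_eq (z : Fin n → Obs X) : minEmpRisk ℓ F h z = empRisk ℓ (A h z) h z := by
  have hmin : ∀ f : F, empRisk ℓ (A h z) h z ≤ empRisk ℓ f.1 h z := fun f => hA.le h hh z f.1 f.2
  have : Nonempty F := ⟨⟨A h z, hA.mem h hh z⟩⟩
  exact le_antisymm (ciInf_le (f := fun f : F => empRisk ℓ f.1 h z)
    ⟨_, Set.forall_mem_range.2 hmin⟩ ⟨A h z, hA.mem h hh z⟩) (le_ciInf hmin)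

lemma minEmpRisk_mem_Icc (hℓ : IsUnitLoss ℓ) (z : Fin n → Obs X) :
    minEmpRisk ℓ F h z ∈ Set.Icc (0 : ℝ) 1 :=
  hA.minEmpRisk_eq hh z ▸ empRisk_mem_Icc hℓ _ _ _

lemma abs_minEmpRisk_le_one (hℓ : IsUnitLoss ℓ) (z : Fin n → Obs X) : |minEmpRisk ℓ F h z| ≤ 1 :=
  have hm := hA.minEmpRisk_mem_Icc hh hℓ z
  (abs_of_nonneg hm.1).trans_le hm.2

lemma abs_minEmpRisk_sub_le_one (hℓ : IsUnitLoss ℓ) (z z' : Fin n → Obs X) :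
    |minEmpRisk ℓ F h z - minEmpRisk ℓ F h z'| ≤ 1 := by
  have hm := hA.minEmpRisk_mem_Icc hh hℓ
  simpa using abs_sub_le_of_le_of_le (hm z).1 (hm z).2 (hm z').1 (hm z').2

lemma abs_minEmpRisk_sub_le (hℓ : IsUnitLoss ℓ) (hF : ∀ f ∈ F, LipschitzWith L f) (hh' : h' ∈ H)
    (z : Fin n → Obs X) : |minEmpRisk ℓ F h z - minEmpRisk ℓ F h' z|
      ≤ L / √n * blockNorm fun i => h (z i).1 - h' (z i).1 := by
  have hle := hA.le h hh z _ (hA.mem h' hh' z)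
  have hle' := hA.le h' hh' z _ (hA.mem h hh z)
  have hdiff := abs_le.1 (abs_empRisk_sub_le hℓ (hF _ (hA.mem h hh z)) h h' z)
  have hdiff' := abs_le.1 (abs_empRisk_sub_le hℓ (hF _ (hA.mem h' hh' z)) h h' z)
  rw [hA.minEmpRisk_eq hh, hA.minEmpRisk_eq hh', abs_le]
  constructor <;> linarith

lemma tendsto_minEmpRisk (hℓ : IsUnitLoss ℓ) (hF : ∀ f ∈ F, LipschitzWith L f)
    {u : ℕ → X → Rep K} (hu : ∀ k, u k ∈ H) (hlim : ∀ x, Tendsto (fun k => u k x) atTop (𝓝 (h x)))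
    (z : Fin n → Obs X) :
    Tendsto (fun k => minEmpRisk ℓ F (u k) z) atTop (𝓝 (minEmpRisk ℓ F h z)) := by
  rw [tendsto_iff_norm_sub_tendsto_zero]
  refine squeeze_zero (fun _ => norm_nonneg _)
    (fun k => hA.abs_minEmpRisk_sub_le (hu k) hℓ hF hh z) ?_
  have hsum : Tendsto (fun k => ∑ i, ‖u k (z i).1 - h (z i).1‖ ^ 2) atTop
      (𝓝 (∑ _i : Fin n, (0 : ℝ) ^ 2)) := tendsto_finsetSum _ fun i _ =>
    (tendsto_iff_norm_sub_tendsto_zero.1 (hlim (z i).1)).pow 2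
  simpa [blockNorm] using hsum.sqrt.const_mul ((L : ℝ) / √n)

lemma measurable_minEmpRisk (hℓ : IsUnitLoss ℓ) (hF : ∀ f ∈ F, LipschitzWith L f)
    (hhm : Measurable h) : Measurable fun z : Fin n → Obs X => minEmpRisk ℓ F h z := by
  simp only [hA.minEmpRisk_eq hh, empRisk]
  have hpred : Measurable (Function.uncurry fun v z => A h z v) :=
    measurable_uncurry_of_continuous_of_measurable
      (fun z => (hF _ (hA.mem h hh z)).continuous) fun v => hA.measurable h hh v
  refine (Finset.measurable_sum _ fun i _ => ?_).const_mul _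
  have hrep : Measurable fun z : Fin n → Obs X => (h (z i).1, z) := by fun_prop
  exact hℓ.measurable_uncurry.comp ((hpred.comp hrep).prodMk (measurable_pi_apply i).snd)

end IsERM

end EmpiricalRisk

section QPrime

variable {n K : ℕ} {F : Set (Rep K → ℝ)}

lemma blockNorm_pos {y : Fin n → Rep K} (hy : y ≠ 0) : 0 < blockNorm y := by
  obtain ⟨i, hi⟩ := Function.ne_iff.1 hy
  exact Real.sqrt_pos.2 (Finset.sum_pos' (fun _ _ => sq_nonneg _)
    ⟨i, Finset.mem_univ i, pow_pos (norm_pos_iff.2 hi) 2⟩)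

lemma inv_blockNorm_mul_gaussAvg_le_QPrime {y : Fin n → Rep K} (hy : y ≠ 0) :
    (((blockNorm y)⁻¹ : ℝ) : EReal) * gaussAvg {v : Fin n → ℝ | ∃ f ∈ F, v = fun i => f (y i)}
      ≤ QPrime n F :=
  le_iSup₂ (f := fun (y : Fin n → Rep K) (_ : y ≠ 0) => (((blockNorm y)⁻¹ : ℝ) : EReal)
    * gaussAvg {v : Fin n → ℝ | ∃ f ∈ F, v = fun i => f (y i)}) y hy

lemma QPrime_nonneg [NeZero n] [NeZero K] (hne : F.Nonempty) : 0 ≤ QPrime n F := by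
  obtain ⟨y, hy⟩ := exists_ne (0 : Fin n → Rep K)
  obtain ⟨f, hf⟩ := hne
  have hne_image : {v : Fin n → ℝ | ∃ f ∈ F, v = fun i => f (y i)}.Nonempty := ⟨_, f, hf, rfl⟩
  exact (mul_nonneg (EReal.coe_nonneg.2 (inv_nonneg.2 (blockNorm_pos hy).le))
    (gaussAvg_nonneg hne_image)).trans (inv_blockNorm_mul_gaussAvg_le_QPrime hy)

lemma coe_toReal_QPrime [NeZero n] [NeZero K] (hne : F.Nonempty) (hQ : QPrime n F ≠ ⊤) :
    ((QPrime n F).toReal : EReal) = QPrime n F :=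
  EReal.coe_toReal hQ (EReal.bot_lt_zero.trans_le (QPrime_nonneg hne)).ne'

lemma gaussAvg_le_QPrime_mul_blockNorm {y : Fin n → Rep K} (hy : y ≠ 0) :
    gaussAvg {v : Fin n → ℝ | ∃ f ∈ F, v = fun i => f (y i)}
      ≤ QPrime n F * ((blockNorm y : ℝ) : EReal) := by
  have hpos := blockNorm_pos hy
  have hle := mul_le_mul_of_nonneg_right (inv_blockNorm_mul_gaussAvg_le_QPrime (F := F) hy)
    (EReal.coe_nonneg.2 hpos.le)
  rwa [mul_right_comm, ← EReal.coe_mul, inv_mul_cancel₀ hpos.ne', EReal.coe_one, one_mul] at hle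

end QPrime

section LossComplexity

variable {X : Type*} {n K : ℕ} {ℓ : ℝ → ℝ → ℝ} {L : ℝ≥0} {F F₀ : Set (Rep K → ℝ)}
  {H H₀ : Set (X → Rep K)}

/-- The Rademacher average of the losses of the predictors `f ∈ 𝓕` on the sample `z` represented
by `h`, without the factor `1 / n`. -/
def lossRad (ℓ : ℝ → ℝ → ℝ) (F : Set (Rep K → ℝ)) (h : X → Rep K) (z : Fin n → Obs X) : ℝ :=
  radAvg fun (f : F) i => ℓ (f.1 (h (z i).1)) (z i).2

lemma abs_lossRad_le (hℓ : IsUnitLoss ℓ) (hne : F.Nonempty) (h : X → Rep K) (z : Fin n → Obs X) :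
    |lossRad ℓ F h z| ≤ n := by
  have := hne.to_subtype
  exact (abs_radAvg_le fun _ _ => hℓ.abs_le_one _ _).trans_eq (mul_one _)

lemma abs_lossRad_sub_le_card (hℓ : IsUnitLoss ℓ) (hne : F.Nonempty) (h : X → Rep K)
    (z z' : Fin n → Obs X) : |lossRad ℓ F h z - lossRad ℓ F h z'| ≤ n := by
  have := hne.to_subtype
  exact abs_radAvg_sub_radAvg_le (fun _ _ => hℓ.abs_le_one _ _) (fun _ _ => hℓ.abs_le_one _ _)
    fun f => (Finset.sum_le_sum fun i _ => hℓ.abs_sub_le_one _ _ _ _).trans_eq (by simp)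

lemma tendsto_lossRad (hℓ : IsUnitLoss ℓ) (hF : ∀ f ∈ F, LipschitzWith L f) (hne : F.Nonempty)
    {u : ℕ → X → Rep K} {h : X → Rep K} (hu : ∀ x, Tendsto (fun k => u k x) atTop (𝓝 (h x)))
    (z : Fin n → Obs X) : Tendsto (fun k => lossRad ℓ F (u k) z) atTop (𝓝 (lossRad ℓ F h z)) := by
  have := hne.to_subtype
  rw [tendsto_iff_norm_sub_tendsto_zero]
  refine squeeze_zero (g := fun k => ∑ i, L * ‖u k (z i).1 - h (z i).1‖) (fun _ => norm_nonneg _)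
    (fun k => abs_radAvg_sub_radAvg_le (fun _ _ => hℓ.abs_le_one _ _)
      (fun _ _ => hℓ.abs_le_one _ _) fun f => Finset.sum_le_sum fun i _ =>
        hℓ.abs_comp_sub_le (hF f.1 f.2) _ _ _) ?_
  simpa using tendsto_finsetSum Finset.univ fun i _ =>
    (tendsto_iff_norm_sub_tendsto_zero.1 (hu (z i).1)).const_mul (L : ℝ)

lemma lossRad_le_of_ne_zero [NeZero n] [NeZero K] (hℓ : IsUnitLoss ℓ) (hF₀ : F₀ ⊆ F)
    (hne : F₀.Nonempty) (hQ : QPrime n F ≠ ⊤) {h : X → Rep K} {z : Fin n → Obs X}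
    (hz : (fun i => h (z i).1) ≠ 0) : lossRad ℓ F₀ h z
      ≤ √(Real.pi / 2) * (QPrime n F).toReal * blockNorm fun i => h (z i).1 := by
  have := hne.to_subtype
  have hgauss : (lossRad ℓ F₀ h z : EReal) ≤ (√(Real.pi / 2) * 1 : ℝ)
      * gaussAvg {v : Fin n → ℝ | ∃ f ∈ F, v = fun i => f (h (z i).1)} :=
    radAvg_le_gaussAvg (Equiv.prodPUnit.{0, 0} (Fin n)) _ (fun (f : F₀) i => f.1 (h (z i).1))
      (Y := {v : Fin n → ℝ | ∃ f ∈ F, v = fun i => f (h (z i).1)})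
      (fun f => ⟨f.1, hF₀ f.2, rfl⟩) (fun _ _ => hℓ.abs_le_one _ _) zero_le_one fun f f' i => by
        simpa [Real.sqrt_sq_eq_abs] using hℓ.abs_sub_le (f.1 (h (z i).1)) (f'.1 (h (z i).1)) (z i).2
  have hle := hgauss.trans (mul_le_mul_of_nonneg_left (gaussAvg_le_QPrime_mul_blockNorm hz)
    (EReal.coe_nonneg.2 (by positivity)))
  rw [← coe_toReal_QPrime (hne.mono hF₀) hQ, ← EReal.coe_mul, ← EReal.coe_mul, mul_one,
    EReal.coe_le_coe_iff, ← mul_assoc] at hle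
  exact hle

-- The definition of `QPrime` says nothing about samples represented by `0`; these are limits of
-- samples with a nonzero representation.
lemma lossRad_le [NeZero n] [NeZero K] (hℓ : IsUnitLoss ℓ) (hF : ∀ f ∈ F, LipschitzWith L f)
    (hF₀ : F₀ ⊆ F) (hne : F₀.Nonempty) (hQ : QPrime n F ≠ ⊤) (h : X → Rep K)
    (z : Fin n → Obs X) : lossRad ℓ F₀ h z
      ≤ √(Real.pi / 2) * (QPrime n F).toReal * blockNorm fun i => h (z i).1 := by
  by_cases hz : (fun i => h (z i).1) = 0
  swap
  · exact lossRad_le_of_ne_zero hℓ hF₀ hne hQ hz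
  obtain ⟨e, he⟩ := exists_ne (0 : Rep K)
  let u (k : ℕ) (x : X) : Rep K := h x + (1 / ((k : ℝ) + 1)) • e
  have hu : ∀ x, Tendsto (fun k => u k x) atTop (𝓝 (h x)) := fun x => by
    simpa [u] using
      ((tendsto_one_div_add_atTop_nhds_zero_nat (𝕜 := ℝ)).smul_const e).const_add (h x)
  have hu_ne : ∀ k, (fun i => u k (z i).1) ≠ 0 := fun k hk => by
    have hzero : u k (z 0).1 = 0 := congrFun hk 0
    rw [show u k (z 0).1 = h (z 0).1 + (1 / ((k : ℝ) + 1)) • e from rfl,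
      show h (z 0).1 = 0 from congrFun hz 0, zero_add] at hzero
    exact smul_ne_zero (by positivity) he hzero
  have hcont : Continuous fun y : Fin n → Rep K => blockNorm y := by
    unfold blockNorm
    fun_prop
  have hnorm : Tendsto (fun k => blockNorm fun i => u k (z i).1) atTop
      (𝓝 (blockNorm fun i => h (z i).1)) :=
    (hcont.tendsto _).comp (tendsto_pi_nhds.2 fun i => hu (z i).1)
  exact le_of_tendsto_of_tendsto' (tendsto_lossRad hℓ (fun f hf => hF f (hF₀ hf)) hne hu z)
    (hnorm.const_mul _) fun k => lossRad_le_of_ne_zero hℓ hF₀ hne hQ (hu_ne k)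

lemma measurable_lossRad [MeasurableSpace X] (hℓ : IsUnitLoss ℓ)
    (hF : ∀ f ∈ F, LipschitzWith L f) (hc : F.Countable) {h : X → Rep K} (hh : Measurable h) :
    Measurable fun z : Fin n → Obs X => lossRad ℓ F h z := by
  have := hc.to_subtype
  exact measurable_radAvg fun f i => (hℓ.measurable_comp
    ((hF f.1 f.2).continuous.measurable.comp hh)).comp (measurable_pi_apply i)

lemma integrable_lossRad [MeasurableSpace X] {P : Measure (Fin n → Obs X)} [IsFiniteMeasure P]
    (hℓ : IsUnitLoss ℓ) (hF : ∀ f ∈ F, LipschitzWith L f) (hc : F.Countable) (hne : F.Nonempty)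
    {h : X → Rep K} (hh : Measurable h) : Integrable (fun z => lossRad ℓ F h z) P :=
  .of_bound (measurable_lossRad hℓ hF hc hh).aestronglyMeasurable n
    (ae_of_all _ (abs_lossRad_le hℓ hne h))

/-- The largest Rademacher average `sup_{h ∈ 𝓗} lossRad ℓ 𝓕 h z` on the sample `z`. -/
def supLossRad (ℓ : ℝ → ℝ → ℝ) (F : Set (Rep K → ℝ)) (H : Set (X → Rep K))
    (z : Fin n → Obs X) : ℝ :=
  ⨆ h : H, lossRad ℓ F h.1 z

lemma bddAbove_lossRad (hℓ : IsUnitLoss ℓ) (hne : F.Nonempty) (z : Fin n → Obs X) :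
    BddAbove (Set.range fun h : H => lossRad ℓ F h.1 z) :=
  ⟨n, Set.forall_mem_range.2 fun h => (abs_le.1 (abs_lossRad_le hℓ hne h.1 z)).2⟩

lemma abs_supLossRad_sub_le (hℓ : IsUnitLoss ℓ) (hne : F.Nonempty) (hH : H.Nonempty)
    (z z' : Fin n → Obs X) : |supLossRad ℓ F H z - supLossRad ℓ F H z'| ≤ n :=
  have := hH.to_subtype
  abs_ciSup_sub_ciSup_le (bddAbove_lossRad hℓ hne z) (bddAbove_lossRad hℓ hne z')
    fun h => abs_lossRad_sub_le_card hℓ hne h.1 z z'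

lemma measurable_supLossRad [MeasurableSpace X] (hℓ : IsUnitLoss ℓ)
    (hF : ∀ f ∈ F, LipschitzWith L f) (hc : F.Countable) (hH : ∀ h ∈ H, Measurable h)
    (hHc : H.Countable) : Measurable fun z : Fin n → Obs X => supLossRad ℓ F H z := by
  have := hHc.to_subtype
  exact Measurable.iSup fun h => measurable_lossRad hℓ hF hc (hH h.1 h.2)

lemma lossRad_le_supLossRad (hℓ : IsUnitLoss ℓ) (hF : ∀ f ∈ F, LipschitzWith L f)
    (hne : F.Nonempty) (hH₀ : IsPointwiseSkeleton H₀ H) {h : X → Rep K} (hh : h ∈ H)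
    (z : Fin n → Obs X) : lossRad ℓ F h z ≤ supLossRad ℓ F H₀ z := by
  obtain ⟨u, hu⟩ := hH₀.exists_tendsto h hh
  exact le_of_tendsto' (tendsto_lossRad hℓ hF hne hu z) fun k =>
    le_ciSup (bddAbove_lossRad hℓ hne z) (u k)

lemma supLossRad_le [NeZero n] [NeZero K] (hℓ : IsUnitLoss ℓ) (hF : ∀ f ∈ F, LipschitzWith L f)
    (hF₀ : F₀ ⊆ F) (hne : F₀.Nonempty) (hQ : QPrime n F ≠ ⊤) (hH₀ : H₀ ⊆ H) (hHne : H₀.Nonempty)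
    (z : Fin n → Obs X) : (supLossRad ℓ F₀ H₀ z : EReal)
      ≤ ((√(Real.pi / 2) : ℝ) : EReal) * QPrime n F
        * ⨆ g ∈ H, ((blockNorm fun i => g (z i).1 : ℝ) : EReal) := by
  have := hHne.to_subtype
  have hQ_nonneg := QPrime_nonneg (n := n) (hne.mono hF₀)
  refine EReal.ge_of_forall_gt_iff_ge.1 fun (x : ℝ) hx => ?_
  obtain ⟨h, hh⟩ := exists_lt_of_lt_ciSup (EReal.coe_lt_coe_iff.1 hx)
  calc (x : EReal) ≤ (lossRad ℓ F₀ h.1 z : EReal) := EReal.coe_le_coe_iff.2 hh.le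
    _ ≤ _ := EReal.coe_le_coe_iff.2 (lossRad_le hℓ hF hF₀ hne hQ h.1 z)
    _ = ((√(Real.pi / 2) : ℝ) : EReal) * QPrime n F * (blockNorm fun i => h.1 (z i).1 : ℝ) := by
        rw [EReal.coe_mul, EReal.coe_mul, coe_toReal_QPrime (hne.mono hF₀) hQ]
    _ ≤ _ := mul_le_mul_of_nonneg_left
        (le_biSup (fun g : X → Rep K => ((blockNorm fun i => g (z i).1 : ℝ) : EReal)) (hH₀ h.2))
        (mul_nonneg (EReal.coe_nonneg.2 (Real.sqrt_nonneg _)) hQ_nonneg)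

end LossComplexity

section SampleLaw

lemma measurable_pi_probabilityMeasure {Ω : Type*} [MeasurableSpace Ω] (n : ℕ) :
    Measurable fun μ : ProbabilityMeasure Ω => Measure.pi fun _ : Fin n => (μ : Measure Ω) := by
  refine Measurable.measure_of_isPiSystem_of_isProbabilityMeasure
    (generateFrom_pi (α := fun _ : Fin n => Ω)).symm isPiSystem_pi ?_
  rintro _ ⟨s, hs, rfl⟩
  simp only [Measure.pi_pi]
  exact Finset.measurable_prod _ fun i _ =>
    (Measure.measurable_coe (hs i (Set.mem_univ i))).comp measurable_subtype_coe

variable {X : Type*} [MeasurableSpace X]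

/-- The Markov kernel sending a task `μ` to the law `μ^n` of an `n`-sample from it. -/
def sampleKernel (X : Type*) [MeasurableSpace X] (n : ℕ) :
    Kernel (ProbabilityMeasure (Obs X)) (Fin n → Obs X) :=
  ⟨fun μ => Measure.pi fun _ : Fin n => (μ : Measure (Obs X)), measurable_pi_probabilityMeasure n⟩

instance (n : ℕ) : IsMarkovKernel (sampleKernel X n) :=
  ⟨fun μ => inferInstanceAs
    (IsProbabilityMeasure (Measure.pi fun _ : Fin n => (μ : Measure (Obs X))))⟩

variable {η : Measure (ProbabilityMeasure (Obs X))} {n : ℕ}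

lemma lintegral_sampleLaw_eval {f : Obs X → ℝ≥0∞} (hf : Measurable f) (i : Fin n) :
    ∫⁻ z, f (z i) ∂(sampleLaw η n) = ∫⁻ p, f p ∂(mixture η) := by
  have hcoe : Measurable fun μ : ProbabilityMeasure (Obs X) => (μ : Measure (Obs X)) :=
    measurable_subtype_coe
  rw [sampleLaw, mixture, Measure.lintegral_bind (f := fun z : Fin n → Obs X => f (z i))
      (measurable_pi_probabilityMeasure n).aemeasurable
      (hf.comp (measurable_pi_apply i)).aemeasurable,
    Measure.lintegral_bind (m := η)
      (μ := fun μ : ProbabilityMeasure (Obs X) => (μ : Measure (Obs X))) hcoe.aemeasurable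
      hf.aemeasurable]
  exact lintegral_congr fun μ =>
    (measurePreserving_eval (fun _ : Fin n => (μ : Measure (Obs X))) i).lintegral_comp hf

lemma ofReal_blockNorm_sq {K : ℕ} (y : Fin n → Rep K) :
    ENNReal.ofReal (blockNorm y) ^ (2 : ℝ) = ∑ i, ‖y i‖ₑ ^ 2 := by
  rw [ENNReal.rpow_two, blockNorm, ← ENNReal.ofReal_pow (Real.sqrt_nonneg _),
    Real.sq_sqrt (Finset.sum_nonneg fun i _ => sq_nonneg _),
    ENNReal.ofReal_sum_of_nonneg fun i _ => sq_nonneg _]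
  exact Finset.sum_congr rfl fun i _ => by rw [ENNReal.ofReal_pow (norm_nonneg _), ofReal_norm]

variable [IsProbabilityMeasure η]

lemma sampleLaw_eq_snd_compProd : sampleLaw η n = (η ⊗ₘ sampleKernel X n).snd :=
  (Measure.snd_compProd η (sampleKernel X n)).symm

instance : IsProbabilityMeasure (sampleLaw η n) := by
  rw [sampleLaw_eq_snd_compProd]
  infer_instance

variable {f : (Fin n → Obs X) → ℝ}

lemma integrable_comp_snd_compProd (hf : Integrable f (sampleLaw η n)) :
    Integrable (fun p : ProbabilityMeasure (Obs X) × (Fin n → Obs X) => f p.2)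
      (η ⊗ₘ sampleKernel X n) := by
  rw [sampleLaw_eq_snd_compProd] at hf
  exact hf.comp_measurable measurable_snd

lemma integrable_integral_pi (hf : Integrable f (sampleLaw η n)) :
    Integrable (fun μ : ProbabilityMeasure (Obs X) =>
      ∫ z, f z ∂(Measure.pi fun _ : Fin n => (μ : Measure (Obs X)))) η :=
  (integrable_comp_snd_compProd hf).integral_compProd

lemma integral_sampleLaw (hf : Integrable f (sampleLaw η n)) :
    ∫ z, f z ∂(sampleLaw η n) = ∫ μ : ProbabilityMeasure (Obs X),
      ∫ z, f z ∂(Measure.pi fun _ : Fin n => (μ : Measure (Obs X))) ∂η := by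
  have hf' := integrable_comp_snd_compProd hf
  rw [sampleLaw_eq_snd_compProd] at hf ⊢
  rw [Measure.snd, integral_map measurable_snd.aemeasurable hf.aestronglyMeasurable,
    Measure.integral_compProd hf']
  rfl

lemma lintegral_blockNorm_le [NeZero n] {K : ℕ} {h : X → Rep K} (hh : Measurable h) :
    ∫⁻ z, ENNReal.ofReal (blockNorm fun i => h (z i).1) ∂(sampleLaw η n)
      ≤ n * ((∫⁻ p, ‖h p.1‖ₑ ^ 2 ∂(mixture η)) / n) ^ (1 / 2 : ℝ) := by
  set I := ∫⁻ p, ‖h p.1‖ₑ ^ 2 ∂(mixture η)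
  have hmeas : Measurable fun z : Fin n → Obs X =>
      ENNReal.ofReal (blockNorm fun i => h (z i).1) := by
    unfold blockNorm
    fun_prop
  have hsum : ∫⁻ z : Fin n → Obs X, ∑ i, ‖h (z i).1‖ₑ ^ 2 ∂(sampleLaw η n) = n * I := by
    have hsq : Measurable fun p : Obs X => ‖h p.1‖ₑ ^ 2 := by fun_prop
    rw [lintegral_finsetSum (f := fun i (z : Fin n → Obs X) => ‖h (z i).1‖ₑ ^ 2) _
      fun i _ => hsq.comp (measurable_pi_apply i)]
    simp_rw [fun i : Fin n => lintegral_sampleLaw_eval (η := η) hsq i]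
    simp [I]
  have hscale : (n : ℝ≥0∞) * I = (n : ℝ≥0∞) ^ (2 : ℝ) * (I / n) := by
    rw [ENNReal.rpow_two, sq, mul_assoc,
      ENNReal.mul_div_cancel (by exact_mod_cast NeZero.ne n) (ENNReal.natCast_ne_top n)]
  have hCS := ENNReal.lintegral_mul_le_Lp_mul_Lq (sampleLaw η n) Real.HolderConjugate.two_two
    hmeas.aemeasurable (aemeasurable_const (b := (1 : ℝ≥0∞)))
  simp only [Pi.mul_apply, mul_one, ofReal_blockNorm_sq, hsum, ENNReal.one_rpow, lintegral_const,
    measure_univ, hscale] at hCS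
  rw [ENNReal.mul_rpow_of_nonneg _ _ (by norm_num), ← ENNReal.rpow_mul] at hCS
  norm_num at hCS ⊢
  exact hCS

end SampleLaw

section EnvRisk

variable {X : Type*} [MeasurableSpace X] {n K : ℕ} {ℓ : ℝ → ℝ → ℝ} {L : ℝ≥0}
  {F F₀ : Set (Rep K → ℝ)} {H : Set (X → Rep K)}
  {A : (X → Rep K) → (Fin n → Obs X) → (Rep K → ℝ)} {h : X → Rep K}

lemma integrable_minEmpRisk (hA : IsERM ℓ H F A) (hℓ : IsUnitLoss ℓ)
    (hF : ∀ f ∈ F, LipschitzWith L f) (hh : h ∈ H) (hhm : Measurable h)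
    {P : Measure (Fin n → Obs X)} [IsFiniteMeasure P] :
    Integrable (fun z => minEmpRisk ℓ F h z) P :=
  .of_bound (hA.measurable_minEmpRisk hh hℓ hF hhm).aestronglyMeasurable 1
    (ae_of_all _ (hA.abs_minEmpRisk_le_one hh hℓ))

lemma integral_loss_sub_minEmpRisk_le [NeZero n] (hA : IsERM ℓ H F A) (hℓ : IsUnitLoss ℓ)
    (hF : ∀ f ∈ F, LipschitzWith L f) (hF₀ : IsPointwiseSkeleton F₀ F) (hh : h ∈ H)
    (hhm : Measurable h) (P : Measure (Obs X)) [IsProbabilityMeasure P] (z : Fin n → Obs X) :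
    ∫ p, ℓ (A h z (h p.1)) p.2 ∂P - minEmpRisk ℓ F h z
      ≤ (n : ℝ)⁻¹ * supDev P (fun (f : F₀) p => ℓ (f.1 (h p.1)) p.2) z := by
  obtain ⟨u, hu⟩ := hF₀.exists_tendsto _ (hA.mem h hh z)
  have hdev := sum_integral_sub_le_supDev_of_tendsto (P := P)
    (g := fun (f : F₀) (p : Obs X) => ℓ (f.1 (h p.1)) p.2)
    (fun f => hℓ.measurable_comp ((hF f.1 (hF₀.subset f.2)).continuous.measurable.comp hhm))
    (fun _ _ => hℓ.abs_le_one _ _) (g' := fun p => ℓ (A h z (h p.1)) p.2)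
    (fun p => ((hℓ.lipschitz p.2).continuous.tendsto _).comp (hu (h p.1))) z
  rw [Finset.sum_sub_distrib, Finset.sum_const, Finset.card_univ, Fintype.card_fin,
    nsmul_eq_mul] at hdev
  have hn : (n : ℝ) ≠ 0 := NeZero.ne _
  calc ∫ p, ℓ (A h z (h p.1)) p.2 ∂P - minEmpRisk ℓ F h z
      = (n : ℝ)⁻¹ * (n * ∫ p, ℓ (A h z (h p.1)) p.2 ∂P
          - ∑ i, ℓ (A h z (h (z i).1)) (z i).2) := by
        rw [hA.minEmpRisk_eq hh, empRisk]
        field_simp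
    _ ≤ _ := mul_le_mul_of_nonneg_left hdev (by positivity)

lemma integral_integral_loss_le [NeZero n] (hA : IsERM ℓ H F A) (hℓ : IsUnitLoss ℓ)
    (hF : ∀ f ∈ F, LipschitzWith L f) (hF₀ : IsPointwiseSkeleton F₀ F) (hne : F₀.Nonempty)
    (hh : h ∈ H) (hhm : Measurable h) (P : Measure (Obs X)) [IsProbabilityMeasure P] :
    ∫ z, ∫ p, ℓ (A h z (h p.1)) p.2 ∂P ∂(Measure.pi fun _ : Fin n => P)
      ≤ ∫ z, minEmpRisk ℓ F h z ∂(Measure.pi fun _ : Fin n => P)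
        + 2 / n * ∫ z, lossRad ℓ F₀ h z ∂(Measure.pi fun _ : Fin n => P) := by
  have := hF₀.countable.to_subtype
  have := hne.to_subtype
  set Q := Measure.pi fun _ : Fin n => P
  let g (f : F₀) (p : Obs X) : ℝ := ℓ (f.1 (h p.1)) p.2
  have hg : ∀ f, Measurable (g f) := fun f =>
    hℓ.measurable_comp ((hF f.1 (hF₀.subset f.2)).continuous.measurable.comp hhm)
  have hg_bdd : ∀ f p, |g f p| ≤ 1 := fun _ _ => hℓ.abs_le_one _ _
  have hm : Integrable (fun z => minEmpRisk ℓ F h z) Q := integrable_minEmpRisk hA hℓ hF hh hhm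
  have hD : Integrable (fun z => (n : ℝ)⁻¹ * supDev P g z) Q :=
    (integrable_supDev hg hg_bdd).const_mul _
  calc ∫ z, ∫ p, ℓ (A h z (h p.1)) p.2 ∂P ∂Q
      ≤ ∫ z, (minEmpRisk ℓ F h z + (n : ℝ)⁻¹ * supDev P g z) ∂Q :=
        integral_mono_of_nonneg (ae_of_all _ fun z => integral_nonneg fun p => hℓ.nonneg _ _)
          (hm.add hD) (ae_of_all _ fun z => sub_le_iff_le_add'.1
            (integral_loss_sub_minEmpRisk_le hA hℓ hF hF₀ hh hhm P z))
    _ = ∫ z, minEmpRisk ℓ F h z ∂Q + (n : ℝ)⁻¹ * ∫ z, supDev P g z ∂Q := by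
        rw [integral_add hm hD, integral_const_mul]
    _ ≤ ∫ z, minEmpRisk ℓ F h z ∂Q + (n : ℝ)⁻¹ * (2 * ∫ z, lossRad ℓ F₀ h z ∂Q) := by
        gcongr
        exact integral_supDev_le_two_mul_integral_radAvg hg hg_bdd
    _ = _ := by ring

variable {η : Measure (ProbabilityMeasure (Obs X))} [IsProbabilityMeasure η]

lemma envRisk_le [NeZero n] (hA : IsERM ℓ H F A) (hℓ : IsUnitLoss ℓ)
    (hF : ∀ f ∈ F, LipschitzWith L f) (hF₀ : IsPointwiseSkeleton F₀ F) (hne : F₀.Nonempty)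
    (hh : h ∈ H) (hhm : Measurable h) :
    envRisk ℓ η A h ≤ ∫ z, minEmpRisk ℓ F h z ∂(sampleLaw η n)
      + 2 / n * ∫ z : Fin n → Obs X, lossRad ℓ F₀ h z ∂(sampleLaw η n) := by
  have hm : Integrable (fun z : Fin n → Obs X => minEmpRisk ℓ F h z) (sampleLaw η n) :=
    integrable_minEmpRisk hA hℓ hF hh hhm
  have hR : Integrable (fun z : Fin n → Obs X => lossRad ℓ F₀ h z) (sampleLaw η n) :=
    integrable_lossRad hℓ (fun f hf => hF f (hF₀.subset hf)) hF₀.countable hne hhm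
  have hRi := (integrable_integral_pi hR).const_mul (2 / (n : ℝ))
  rw [integral_sampleLaw hm, integral_sampleLaw hR, ← integral_const_mul,
    ← integral_add (integrable_integral_pi hm) hRi]
  exact integral_mono_of_nonneg (ae_of_all _ fun μ => integral_nonneg fun z =>
      integral_nonneg fun p => hℓ.nonneg _ _) ((integrable_integral_pi hm).add hRi)
    (ae_of_all _ fun μ => integral_integral_loss_le hA hℓ hF hF₀ hne hh hhm μ)

lemma two_div_mul_integral_lossRad_le [NeZero n] [NeZero K] (hℓ : IsUnitLoss ℓ)
    (hF : ∀ f ∈ F, LipschitzWith L f) (hF₀ : F₀ ⊆ F) (hc : F₀.Countable) (hne : F₀.Nonempty)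
    (hQ : QPrime n F ≠ ⊤) (hhm : Measurable h) :
    ((2 / n * ∫ z : Fin n → Obs X, lossRad ℓ F₀ h z ∂(sampleLaw η n) : ℝ) : EReal)
      ≤ ((√(2 * Real.pi) : ℝ) : EReal) * QPrime n F
        * ((((∫⁻ p, ‖h p.1‖ₑ ^ 2 ∂(mixture η)) / (n : ℝ≥0∞)) ^ (1 / 2 : ℝ) : ℝ≥0∞) : EReal) := by
  set q := (QPrime n F).toReal
  set S := ((∫⁻ p, ‖h p.1‖ₑ ^ 2 ∂(mixture η)) / (n : ℝ≥0∞)) ^ (1 / 2 : ℝ)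
  have hn : (n : ℝ) ≠ 0 := NeZero.ne _
  have hq : 0 ≤ q := EReal.toReal_nonneg (QPrime_nonneg (hne.mono hF₀))
  have hR : Integrable (fun z : Fin n → Obs X => 2 / n * lossRad ℓ F₀ h z) (sampleLaw η n) :=
    (integrable_lossRad hℓ (fun f hf => hF f (hF₀ hf)) hc hne hhm).const_mul _
  have hpoint : ∀ z : Fin n → Obs X, 2 / n * lossRad ℓ F₀ h z
      ≤ √(2 * Real.pi) * q / n * blockNorm fun i => h (z i).1 := fun z =>
    (mul_le_mul_of_nonneg_left (lossRad_le hℓ hF hF₀ hne hQ h z) (by positivity)).trans_eq (by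
      rw [← two_mul_sqrt_pi_div_two]
      ring)
  have hle : ENNReal.ofReal (2 / n * ∫ z : Fin n → Obs X, lossRad ℓ F₀ h z ∂(sampleLaw η n))
      ≤ ENNReal.ofReal (√(2 * Real.pi) * q) * S := by
    rw [← integral_const_mul]
    calc _ ≤ _ := ofReal_integral_le_mul_lintegral hR (by positivity) hpoint
      _ ≤ ENNReal.ofReal (√(2 * Real.pi) * q / n) * (n * S) := by
          gcongr
          exact lintegral_blockNorm_le hhm
      _ = ENNReal.ofReal (√(2 * Real.pi) * q) * S := by
          rw [← mul_assoc, ← ENNReal.ofReal_natCast, ← ENNReal.ofReal_mul (by positivity),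
            div_mul_cancel₀ _ hn]
  have hle' := EReal.coe_ennreal_le_coe_ennreal_iff.2 hle
  rw [EReal.coe_ennreal_mul, EReal.coe_ennreal_ofReal, EReal.coe_ennreal_ofReal,
    max_eq_left (by positivity : 0 ≤ √(2 * Real.pi) * q), EReal.coe_mul,
    coe_toReal_QPrime (hne.mono hF₀) hQ] at hle'
  exact (EReal.coe_le_coe_iff.2 (le_max_left _ _)).trans hle'

end EnvRisk

section MultiTask

variable {X : Type*} [MeasurableSpace X] {n K T : ℕ} {ℓ : ℝ → ℝ → ℝ} {L : ℝ≥0}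
  {F F₀ : Set (Rep K → ℝ)} {H H₀ : Set (X → Rep K)}
  {A : (X → Rep K) → (Fin n → Obs X) → (Rep K → ℝ)}

lemma radAvg_minEmpRisk_le (hA : IsERM ℓ H F A) (hℓ : IsUnitLoss ℓ)
    (hF : ∀ f ∈ F, LipschitzWith L f) (hH₀ : H₀ ⊆ H) (hne : H₀.Nonempty)
    (Z : Fin T → Fin n → Obs X) :
    ((2 / T * radAvg fun (h : H₀) t => minEmpRisk ℓ F h.1 (Z t) : ℝ) : EReal)
      ≤ ((√(2 * Real.pi) * L / (T * √n) : ℝ) : EReal)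
        * gaussAvg (repImage H fun t i => (Z t i).1) := by
  have := hne.to_subtype
  let e : Fin T × (Fin n × Fin K) ≃ Fin K × Fin T × Fin n :=
    (Equiv.prodAssoc _ _ _).symm.trans (Equiv.prodComm _ _)
  have hgauss := radAvg_le_gaussAvg e (fun (h : H₀) t => minEmpRisk ℓ F h.1 (Z t))
    (fun h p => h.1 (Z p.2.1 p.2.2).1 p.1) (Y := repImage H fun t i => (Z t i).1)
    (fun h => ⟨h.1, hH₀ h.2, rfl⟩) (fun h t => hA.abs_minEmpRisk_le_one (hH₀ h.2) hℓ (Z t))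
    (b := L / √n) (by positivity) fun h h' t =>
      (hA.abs_minEmpRisk_sub_le (hH₀ h.2) hℓ hF (hH₀ h'.2) (Z t)).trans_eq (by
        simp [e, blockNorm, Fintype.sum_prod_type, EuclideanSpace.norm_sq_eq])
  calc ((2 / T * radAvg fun (h : H₀) t => minEmpRisk ℓ F h.1 (Z t) : ℝ) : EReal)
      ≤ ((2 / T : ℝ) : EReal) * (((√(Real.pi / 2) * (L / √n) : ℝ) : EReal)
        * gaussAvg (repImage H fun t i => (Z t i).1)) := by
        rw [EReal.coe_mul]
        exact mul_le_mul_of_nonneg_left hgauss (EReal.coe_nonneg.2 (by positivity))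
    _ = _ := by
        rw [← mul_assoc, ← EReal.coe_mul, ← two_mul_sqrt_pi_div_two]
        congr 2
        ring

variable (ℓ F A) in
/-- The excess `𝓔_η(h) - (1 / T) ∑_t m(h)_{Z_t}` of the environment risk over its empirical
counterpart on the multisample `Z`. -/
def excessRisk (η : Measure (ProbabilityMeasure (Obs X))) (h : X → Rep K)
    (Z : Fin T → Fin n → Obs X) : ℝ :=
  envRisk ℓ η A h - 1 / (T : ℝ) * ∑ t, minEmpRisk ℓ F h (Z t)

variable {η : Measure (ProbabilityMeasure (Obs X))} [IsProbabilityMeasure η]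

lemma excessRisk_le [NeZero n] [NeZero T] (hA : IsERM ℓ H F A) (hℓ : IsUnitLoss ℓ)
    (hF : ∀ f ∈ F, LipschitzWith L f) (hF₀ : IsPointwiseSkeleton F₀ F) (hne : F₀.Nonempty)
    (hH₀ : IsPointwiseSkeleton H₀ H) (hHm : ∀ h ∈ H, Measurable h) {h : X → Rep K} (hh : h ∈ H)
    (Z : Fin T → Fin n → Obs X) :
    excessRisk ℓ F A η h Z
      ≤ (T : ℝ)⁻¹ * supDev (sampleLaw η n) (fun (h : H₀) z => minEmpRisk ℓ F h.1 z) Z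
        + 2 / n * ∫ z : Fin n → Obs X, lossRad ℓ F₀ h z ∂(sampleLaw η n) := by
  have hrisk := envRisk_le (η := η) hA hℓ hF hF₀ hne hh (hHm h hh)
  obtain ⟨u, hu⟩ := hH₀.exists_tendsto h hh
  have hdev := sum_integral_sub_le_supDev_of_tendsto (P := sampleLaw η n)
    (g := fun (h : H₀) z => minEmpRisk ℓ F h.1 z)
    (fun h => hA.measurable_minEmpRisk (hH₀.subset h.2) hℓ hF (hHm _ (hH₀.subset h.2)))
    (fun h => hA.abs_minEmpRisk_le_one (hH₀.subset h.2) hℓ)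
    (hA.tendsto_minEmpRisk hh hℓ hF (fun k => hH₀.subset (u k).2) hu) Z
  rw [Finset.sum_sub_distrib, Finset.sum_const, Finset.card_univ, Fintype.card_fin,
    nsmul_eq_mul] at hdev
  have hT : (T : ℝ) ≠ 0 := NeZero.ne _
  have hscaled := mul_le_mul_of_nonneg_left hdev (inv_nonneg.2 (Nat.cast_nonneg (α := ℝ) T))
  rw [mul_sub, inv_mul_cancel_left₀ hT] at hscaled
  rw [excessRisk, one_div]
  linarith

-- `V` is a statistic of the sample whose expectation is to be estimated along with the risk:
-- `V = 0` in part (i), `V = (2 / n) * supLossRad` in part (ii).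
lemma measureReal_lt_excessRisk_le [NeZero n] [NeZero T] (hA : IsERM ℓ H F A)
    (hℓ : IsUnitLoss ℓ) (hF : ∀ f ∈ F, LipschitzWith L f) (hF₀ : IsPointwiseSkeleton F₀ F)
    (hne : F₀.Nonempty) (hH₀ : IsPointwiseSkeleton H₀ H) (hHne : H₀.Nonempty)
    (hHm : ∀ h ∈ H, Measurable h) {V : (Fin n → Obs X) → ℝ} {v : ℝ} (hV : Measurable V)
    (hV_osc : ∀ z z', |V z - V z'| ≤ v) {ε : ℝ} (hε : 0 ≤ ε) :
    (Measure.pi fun _ : Fin T => sampleLaw η n).real {Z | ∃ h ∈ H,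
      2 / T * radAvg (fun (h : H₀) t => minEmpRisk ℓ F h.1 (Z t))
        + (2 / n * ∫ z, lossRad ℓ F₀ h z ∂(sampleLaw η n)
          + ((T : ℝ)⁻¹ * ∑ t, V (Z t) - ∫ z, V z ∂(sampleLaw η n))) + ε
        < excessRisk ℓ F A η h Z}
      ≤ Real.exp (-2 * (T * ε) ^ 2 / (T * (3 + v) ^ 2)) := by
  have := hH₀.countable.to_subtype
  have := hHne.to_subtype
  have hT : 0 < (T : ℝ) := Nat.cast_pos.2 (NeZero.pos T)
  set ρ := sampleLaw η n
  let m (h : H₀) (z : Fin n → Obs X) : ℝ := minEmpRisk ℓ F h.1 z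
  have htail := measureReal_le_supDev_sub_radAvg_le (P := ρ) (n := T) (g := m)
    (fun h => hA.measurable_minEmpRisk (hH₀.subset h.2) hℓ hF (hHm _ (hH₀.subset h.2)))
    (fun h => hA.abs_minEmpRisk_le_one (hH₀.subset h.2) hℓ)
    (fun h => hA.abs_minEmpRisk_sub_le_one (hH₀.subset h.2) hℓ) hV hV_osc (mul_nonneg hT.le hε)
  rw [mul_one] at htail
  refine (measureReal_mono ?_).trans htail
  rintro Z ⟨h, hh, hlt⟩
  have hdev := hlt.trans_le (excessRisk_le hA hℓ hF hF₀ hne hH₀ hHm hh Z)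
  have hscale : (T : ℝ)⁻¹ * (supDev ρ m Z - 2 * radAvg (fun h t => m h (Z t))
        - (∑ t, V (Z t) - T * ∫ z, V z ∂ρ))
      = (T : ℝ)⁻¹ * supDev ρ m Z - 2 / T * radAvg (fun h t => m h (Z t))
        - ((T : ℝ)⁻¹ * ∑ t, V (Z t) - ∫ z, V z ∂ρ) := by
    field_simp
  exact (le_inv_mul_iff₀ hT).1 (by linarith)

lemma measure_not_forall_excessRisk_le [NeZero n] [NeZero T] (hA : IsERM ℓ H F A)
    (hℓ : IsUnitLoss ℓ) (hF : ∀ f ∈ F, LipschitzWith L f) (hF₀ : IsPointwiseSkeleton F₀ F)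
    (hne : F₀.Nonempty) (hH₀ : IsPointwiseSkeleton H₀ H) (hHne : H₀.Nonempty)
    (hHm : ∀ h ∈ H, Measurable h) {V : (Fin n → Obs X) → ℝ} {v : ℝ} (hV : Measurable V)
    (hv : 0 ≤ v) (hV_osc : ∀ z z', |V z - V z'| ≤ v) {B : (Fin T → Fin n → Obs X) → EReal}
    (hB : ∀ Z, ∀ h ∈ H, ((2 / n * ∫ z, lossRad ℓ F₀ h z ∂(sampleLaw η n)
      + ((T : ℝ)⁻¹ * ∑ t, V (Z t) - ∫ z, V z ∂(sampleLaw η n)) : ℝ) : EReal) ≤ B Z)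
    {δ ε : ℝ} (hδ : 0 < δ) (hε : 0 ≤ ε) (hδε : (3 + v) ^ 2 * Real.log (1 / δ) ≤ 2 * T * ε ^ 2) :
    (Measure.pi fun _ : Fin T => sampleLaw η n) {Z : Fin T → Fin n → Obs X | ¬ ∀ h ∈ H,
      ((excessRisk ℓ F A η h Z : ℝ) : EReal) ≤ ((√(2 * Real.pi) * L / (T * √n) : ℝ) : EReal)
        * gaussAvg (repImage H fun t i => (Z t i).1) + B Z + (ε : EReal)} ≤ ENNReal.ofReal δ := by
  have htail := (measureReal_lt_excessRisk_le (η := η) (T := T) hA hℓ hF hF₀ hne hH₀ hHne hHm hV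
    hV_osc hε).trans (exp_neg_two_mul_sq_div_le (by positivity) hδ hδε)
  have htail' := ENNReal.ofReal_le_ofReal htail
  rw [ofReal_measureReal] at htail'
  refine (measure_mono fun Z hZ => ?_).trans htail'
  by_contra hnot
  refine hZ fun h hh => ?_
  have hexcess := not_lt.1 fun hlt => hnot ⟨h, hh, hlt⟩
  refine (EReal.coe_le_coe_iff.2 hexcess).trans ?_
  rw [EReal.coe_add, EReal.coe_add]
  exact add_le_add (add_le_add (radAvg_minEmpRisk_le hA hℓ hF hH₀.subset hHne Z) (hB Z h hh))
    le_rfl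

lemma two_div_mul_integral_lossRad_le_iSup [NeZero n] [NeZero K] (hℓ : IsUnitLoss ℓ)
    (hF : ∀ f ∈ F, LipschitzWith L f) (hF₀ : F₀ ⊆ F) (hc : F₀.Countable) (hne : F₀.Nonempty)
    (hQ : QPrime n F ≠ ⊤) (hHm : ∀ h ∈ H, Measurable h) {h : X → Rep K} (hh : h ∈ H) :
    ((2 / n * ∫ z : Fin n → Obs X, lossRad ℓ F₀ h z ∂(sampleLaw η n) : ℝ) : EReal)
      ≤ ((√(2 * Real.pi) : ℝ) : EReal) * QPrime n F
        * ((⨆ g ∈ H, ((∫⁻ p, ‖g p.1‖ₑ ^ 2 ∂(mixture η)) / (n : ℝ≥0∞)) ^ (1 / 2 : ℝ) :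
            ℝ≥0∞) : EReal) := by
  have hsup := le_biSup (fun g : X → Rep K =>
    ((∫⁻ p, ‖g p.1‖ₑ ^ 2 ∂(mixture η)) / (n : ℝ≥0∞)) ^ (1 / 2 : ℝ)) hh
  refine (two_div_mul_integral_lossRad_le hℓ hF hF₀ hc hne hQ (hHm h hh)).trans ?_
  exact mul_le_mul_of_nonneg_left (EReal.coe_ennreal_le_coe_ennreal_iff.2 hsup)
    (mul_nonneg (EReal.coe_nonneg.2 (Real.sqrt_nonneg _)) (QPrime_nonneg (hne.mono hF₀)))

omit [MeasurableSpace X] in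
lemma abs_two_div_mul_supLossRad_sub_le [NeZero n] (hℓ : IsUnitLoss ℓ) (hne : F.Nonempty)
    (hH : H.Nonempty) (z z' : Fin n → Obs X) :
    |2 / n * supLossRad ℓ F H z - 2 / n * supLossRad ℓ F H z'| ≤ 2 := by
  have hn : (n : ℝ) ≠ 0 := NeZero.ne _
  rw [← mul_sub, abs_mul, abs_of_nonneg (by positivity)]
  calc 2 / n * |supLossRad ℓ F H z - supLossRad ℓ F H z'| ≤ 2 / n * n := by
        gcongr
        exact abs_supLossRad_sub_le hℓ hne hH z z'
    _ = 2 := div_mul_cancel₀ _ hn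

lemma integral_lossRad_le_integral_supLossRad (hℓ : IsUnitLoss ℓ)
    (hF : ∀ f ∈ F, LipschitzWith L f) (hc : F.Countable) (hne : F.Nonempty)
    (hH₀ : IsPointwiseSkeleton H₀ H) (hHm : ∀ h ∈ H, Measurable h) {h : X → Rep K} (hh : h ∈ H) :
    ∫ z : Fin n → Obs X, lossRad ℓ F h z ∂(sampleLaw η n)
      ≤ ∫ z, supLossRad ℓ F H₀ z ∂(sampleLaw η n) :=
  integral_mono (integrable_lossRad hℓ hF hc hne (hHm h hh))
    (integrable_of_abs_sub_le (measurable_supLossRad hℓ hF hc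
      (fun g hg => hHm g (hH₀.subset hg)) hH₀.countable)
      (abs_supLossRad_sub_le hℓ hne (hH₀.nonempty ⟨h, hh⟩)))
    (lossRad_le_supLossRad hℓ hF hne hH₀ hh)

omit [MeasurableSpace X] in
lemma inv_mul_sum_two_div_mul_supLossRad_le [NeZero n] [NeZero K] (hℓ : IsUnitLoss ℓ)
    (hF : ∀ f ∈ F, LipschitzWith L f) (hF₀ : F₀ ⊆ F) (hne : F₀.Nonempty) (hQ : QPrime n F ≠ ⊤)
    (hH₀ : H₀ ⊆ H) (hHne : H₀.Nonempty) (Z : Fin T → Fin n → Obs X) :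
    (((T : ℝ)⁻¹ * ∑ t, 2 / n * supLossRad ℓ F₀ H₀ (Z t) : ℝ) : EReal)
      ≤ ((√(2 * Real.pi) / (n * T) : ℝ) : EReal) * QPrime n F
        * ∑ t, ⨆ g ∈ H, ((blockNorm fun i => g (Z t i).1 : ℝ) : EReal) := by
  set q := (QPrime n F).toReal
  have hq : (q : EReal) = QPrime n F := coe_toReal_QPrime (hne.mono hF₀) hQ
  have hq_nonneg : 0 ≤ q := EReal.toReal_nonneg (QPrime_nonneg (hne.mono hF₀))
  rw [← hq, ← EReal.coe_mul, coe_mul_sum_of_nonneg _ (by positivity), Finset.mul_sum,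
    coe_sum_eq_sum_coe]
  refine Finset.sum_le_sum fun t _ => ?_
  have hle := mul_le_mul_of_nonneg_left (supLossRad_le hℓ hF hF₀ hne hQ hH₀ hHne (Z t))
    (EReal.coe_nonneg.2 (by positivity : 0 ≤ (T : ℝ)⁻¹ * (2 / n)))
  rw [← hq, ← EReal.coe_mul, ← EReal.coe_mul, ← mul_assoc, ← EReal.coe_mul, mul_assoc] at hle
  refine hle.trans_eq ?_
  congr 2
  rw [← two_mul_sqrt_pi_div_two]
  field_simp

lemma two_div_mul_integral_lossRad_add_le_sum [NeZero n] [NeZero K] (hℓ : IsUnitLoss ℓ)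
    (hF : ∀ f ∈ F, LipschitzWith L f) (hF₀ : F₀ ⊆ F) (hc : F₀.Countable) (hne : F₀.Nonempty)
    (hQ : QPrime n F ≠ ⊤) (hH₀ : IsPointwiseSkeleton H₀ H) (hHm : ∀ h ∈ H, Measurable h)
    {h : X → Rep K} (hh : h ∈ H) (Z : Fin T → Fin n → Obs X) :
    ((2 / n * ∫ z, lossRad ℓ F₀ h z ∂(sampleLaw η n)
      + ((T : ℝ)⁻¹ * ∑ t, 2 / n * supLossRad ℓ F₀ H₀ (Z t)
        - ∫ z, 2 / n * supLossRad ℓ F₀ H₀ z ∂(sampleLaw η n)) : ℝ) : EReal)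
      ≤ ((√(2 * Real.pi) / (n * T) : ℝ) : EReal) * QPrime n F
        * ∑ t, ⨆ g ∈ H, ((blockNorm fun i => g (Z t i).1 : ℝ) : EReal) := by
  have hmono := mul_le_mul_of_nonneg_left (integral_lossRad_le_integral_supLossRad (η := η)
    (n := n) hℓ (fun f hf => hF f (hF₀ hf)) hc hne hH₀ hHm hh) (by positivity : (0 : ℝ) ≤ 2 / n)
  refine (EReal.coe_le_coe_iff.2 ?_).trans (inv_mul_sum_two_div_mul_supLossRad_le hℓ hF hF₀ hne
    hQ hH₀.subset (hH₀.nonempty ⟨h, hh⟩) Z)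
  rw [integral_const_mul]
  linarith

lemma measure_not_forall_excessRisk_le_mixture [NeZero n] [NeZero K] [NeZero T]
    (hA : IsERM ℓ H F A) (hℓ : IsUnitLoss ℓ) (hF : ∀ f ∈ F, LipschitzWith L f)
    (hF₀ : IsPointwiseSkeleton F₀ F) (hne : F₀.Nonempty) (hQ : QPrime n F ≠ ⊤)
    (hH₀ : IsPointwiseSkeleton H₀ H) (hHne : H₀.Nonempty) (hHm : ∀ h ∈ H, Measurable h)
    {δ ε : ℝ} (hδ : 0 < δ) (hε : 0 ≤ ε) (hδε : 9 * Real.log (1 / δ) ≤ 2 * T * ε ^ 2) :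
    (Measure.pi fun _ : Fin T => sampleLaw η n) {Z : Fin T → Fin n → Obs X | ¬ ∀ h ∈ H,
      ((excessRisk ℓ F A η h Z : ℝ) : EReal) ≤ ((√(2 * Real.pi) * L / (T * √n) : ℝ) : EReal)
        * gaussAvg (repImage H fun t i => (Z t i).1)
        + ((√(2 * Real.pi) : ℝ) : EReal) * QPrime n F
          * ((⨆ g ∈ H, ((∫⁻ p, ‖g p.1‖ₑ ^ 2 ∂(mixture η)) / (n : ℝ≥0∞)) ^ (1 / 2 : ℝ) :
              ℝ≥0∞) : EReal) + (ε : EReal)} ≤ ENNReal.ofReal δ :=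
  measure_not_forall_excessRisk_le hA hℓ hF hF₀ hne hH₀ hHne hHm (V := fun _ => 0) (v := 0)
    measurable_const le_rfl (by simp)
    (fun _ h hh => by
      simpa using two_div_mul_integral_lossRad_le_iSup hℓ hF hF₀.subset hF₀.countable hne hQ hHm hh)
    hδ hε (hδε.trans_eq' (by ring))

lemma measure_not_forall_excessRisk_le_blockNorm [NeZero n] [NeZero K] [NeZero T]
    (hA : IsERM ℓ H F A) (hℓ : IsUnitLoss ℓ) (hF : ∀ f ∈ F, LipschitzWith L f)
    (hF₀ : IsPointwiseSkeleton F₀ F) (hne : F₀.Nonempty) (hQ : QPrime n F ≠ ⊤)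
    (hH₀ : IsPointwiseSkeleton H₀ H) (hHne : H₀.Nonempty) (hHm : ∀ h ∈ H, Measurable h)
    {δ ε : ℝ} (hδ : 0 < δ) (hε : 0 ≤ ε) (hδε : 25 * Real.log (1 / δ) ≤ 2 * T * ε ^ 2) :
    (Measure.pi fun _ : Fin T => sampleLaw η n) {Z : Fin T → Fin n → Obs X | ¬ ∀ h ∈ H,
      ((excessRisk ℓ F A η h Z : ℝ) : EReal) ≤ ((√(2 * Real.pi) * L / (T * √n) : ℝ) : EReal)
        * gaussAvg (repImage H fun t i => (Z t i).1)
        + ((√(2 * Real.pi) / (n * T) : ℝ) : EReal) * QPrime n F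
          * (∑ t, ⨆ g ∈ H, ((blockNorm fun i => g (Z t i).1 : ℝ) : EReal))
        + (ε : EReal)} ≤ ENNReal.ofReal δ :=
  measure_not_forall_excessRisk_le hA hℓ hF hF₀ hne hH₀ hHne hHm
    (V := fun z => 2 / n * supLossRad ℓ F₀ H₀ z) (v := 2)
    ((measurable_supLossRad hℓ (fun f hf => hF f (hF₀.subset hf)) hF₀.countable
      (fun g hg => hHm g (hH₀.subset hg)) hH₀.countable).const_mul _)
    zero_le_two (abs_two_div_mul_supLossRad_sub_le hℓ hne hHne)
    (fun Z _ hh => two_div_mul_integral_lossRad_add_le_sum hℓ hF hF₀.subset hF₀.countable hne hQ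
      hH₀ hHm hh Z) hδ hε (hδε.trans_eq' (by ring))

end MultiTask

end MTRL

end

open MTRL

theorem theorem14 {X : Type*} [MeasurableSpace X] (K n T : ℕ)
    (hK : 0 < K) (hn : 0 < n) (hT : 0 < T)
    -- the loss
    (ℓ : ℝ → ℝ → ℝ) (hℓ_range : ∀ u y, ℓ u y ∈ Set.Icc (0 : ℝ) 1)
    (hℓ_lip : ∀ y, LipschitzWith 1 fun u => ℓ u y) (hℓ_meas : ∀ u, Measurable (ℓ u))
    -- the specialized predictors and the representations
    (L : ℝ≥0) (hL : 0 < L)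
    (F : Set (MTRL.Rep K → ℝ)) (hF : ∀ f ∈ F, LipschitzWith L f)
    (hQ : MTRL.QPrime n F ≠ ⊤)
    (H : Set (X → MTRL.Rep K)) (hH_meas : ∀ h ∈ H, Measurable h)
    (hH_sep : MTRL.PointwiseSeparable H)
    -- the algorithm
    (A : (X → MTRL.Rep K) → (Fin n → MTRL.Obs X) → (MTRL.Rep K → ℝ))
    (hA : MTRL.IsERM ℓ H F A)
    -- the environment
    (η : Measure (ProbabilityMeasure (MTRL.Obs X))) [IsProbabilityMeasure η]
    (δ : ℝ) (hδ : δ ∈ Set.Ioo (0 : ℝ) 1) :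
    -- (i) the bad event has outer measure at most `δ`
    (Measure.pi fun _ : Fin T => MTRL.sampleLaw η n)
      {Z : Fin T → Fin n → MTRL.Obs X | ¬ ∀ h ∈ H,
        ((MTRL.envRisk ℓ η A h - (1 / (T : ℝ)) * ∑ t, MTRL.minEmpRisk ℓ F h (Z t) : ℝ) : EReal) ≤
          ((√(2 * Real.pi) * L / (T * √n) : ℝ) : EReal)
              * MTRL.gaussAvg (MTRL.repImage H fun t i => (Z t i).1)
            + ((√(2 * Real.pi) : ℝ) : EReal) * MTRL.QPrime n F
              * ((⨆ g ∈ H, ((∫⁻ p, ‖g p.1‖ₑ ^ 2 ∂(MTRL.mixture η)) / (n : ℝ≥0∞)) ^ (1 / 2 : ℝ) :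
                  ℝ≥0∞) : EReal)
            + ((√(9 * Real.log (2 / δ) / (2 * T)) : ℝ) : EReal)} ≤ ENNReal.ofReal δ
    ∧
    -- (ii)
    (Measure.pi fun _ : Fin T => MTRL.sampleLaw η n)
      {Z : Fin T → Fin n → MTRL.Obs X | ¬ ∀ h ∈ H,
        ((MTRL.envRisk ℓ η A h - (1 / (T : ℝ)) * ∑ t, MTRL.minEmpRisk ℓ F h (Z t) : ℝ) : EReal) ≤
          ((√(2 * Real.pi) * L / (T * √n) : ℝ) : EReal)
              * MTRL.gaussAvg (MTRL.repImage H fun t i => (Z t i).1)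
            + ((√(2 * Real.pi) / (n * T) : ℝ) : EReal) * MTRL.QPrime n F
              * (∑ t, ⨆ g ∈ H, ((MTRL.blockNorm fun i => g (Z t i).1 : ℝ) : EReal))
            + ((√(16 * Real.log (4 / δ) / T) : ℝ) : EReal)} ≤ ENNReal.ofReal δ := by
  have : NeZero K := ⟨hK.ne'⟩
  have : NeZero n := ⟨hn.ne'⟩
  have : NeZero T := ⟨hT.ne'⟩
  have hT' : (0 : ℝ) < T := Nat.cast_pos.2 hT
  rcases H.eq_empty_or_nonempty with rfl | ⟨h₀, hh₀⟩
  · simp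
  have hℓ : IsUnitLoss ℓ := ⟨hℓ_range, hℓ_lip, hℓ_meas⟩
  obtain ⟨H₀, hH₀⟩ := hH_sep.exists_isPointwiseSkeleton
  obtain ⟨F₀, hF₀⟩ := exists_isPointwiseSkeleton_of_continuous fun f hf => (hF f hf).continuous
  obtain ⟨z₀⟩ := nonempty_of_isProbabilityMeasure (sampleLaw η n)
  have hF₀_ne : F₀.Nonempty := hF₀.nonempty ⟨_, hA.mem h₀ hh₀ z₀⟩
  have hH₀_ne : H₀.Nonempty := hH₀.nonempty ⟨h₀, hh₀⟩
  constructor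
  · refine measure_not_forall_excessRisk_le_mixture hA hℓ hF hF₀ hF₀_ne hQ hH₀ hH₀_ne hH_meas
      hδ.1 (Real.sqrt_nonneg _) ?_
    exact mul_log_one_div_le_two_mul_sq_sqrt (a := 2) (c' := 9) hδ one_le_two (by norm_num)
      le_rfl hT' (by field_simp)
  · refine measure_not_forall_excessRisk_le_blockNorm hA hℓ hF hF₀ hF₀_ne hQ hH₀ hH₀_ne hH_meas
      hδ.1 (Real.sqrt_nonneg _) ?_
    exact mul_log_one_div_le_two_mul_sq_sqrt (a := 4) (c' := 32) hδ (by norm_num) (by norm_num)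
      (by norm_num) hT' (by field_simp; ring)
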